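/- **Setting.** Fix a countably infinite set $\Delta$ of constants (standard names), concept names $N$, role names $P$ and service function symbols $f$ with arities. Roles are $R ::= P\mid P^-$, basic concepts are $B::=N\mid\exists R$. A DL-Lite$_{\mathcal A}$ TBox $T$ is a finite set of positive inclusions $B_1\sqsubseteq B_2$, $R_1\sqsubseteq R_2$, negative inclusions $B_1\sqsubseteq\neg B_2$, $R_1\sqsubseteq\neg R_2$ and functionality assertions $(\mathrm{funct}\,R)$, where no functional role or inverse of one is the right-hand side of a positive role inclusion. An ABox $A$ is a finite set of facts $N(d)$, $P(d,d')$ over $\Delta$, and $\mathrm{adom}(A)$ is the set of constants in it. Models are first-order models under the unique name assumption. $A$ is $T$-consistent if $(T,A)$ has a model; a repair of $A$ is a maximal $T$-consistent subset of $A$. A UCQ is a finite disjunction of existentially quantified finite conjunctions of atoms, all with the same free variables, each of which occurs in every disjunct. The consistent-query answers to a UCQ $q$ over $(T,A)$ are the assignments $\sigma$ of its free variables to $\mathrm{adom}(A)$ such that $q\sigma$ is true in every model of $(T,A_r)$, for every repair $A_r$ of $A$. An ECQ is built from UCQs with $\neg,\wedge,\exists$; its consistent-query answers (with values in $\mathrm{adom}(A)$)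 are obtained by composing those of its UCQs through first-order constructs, with quantifiers ranging over $\mathrm{adom}(A)$. A *KAB* is $\mathcal K=(T,A_0,\Gamma,\Pi)$ with $T$ a TBox, $A_0$ a $T$-consistent ABox, $\Gamma$ a finite set of actions and $\Pi$ a finite set of rules $Q\mapsto\alpha$, where $\alpha\in\Gamma$ and $Q$ is an ECQ whose free variables are exactly the parameters of $\alpha$. An action has finitely many parameters and finitely many effects $[q^+]\wedge Q^-\rightsquigarrow E$, where $q^+$ is a UCQ (action parameters may be among its free variables), $Q^-$ is an ECQ whose free variables are among those of $q^+$, and $E$ is a finite set of facts whose terms are constants of $\mathrm{adom}(A_0)$, free variables of $q^+$, and service calls $f(\vec x)$ with $\vec x$ free variables of $q^+$. The *inconsistency-tolerant transition system* $\Upsilon^{it}_{\mathcal K}$ has states $\langle A,m\rangle$, with $A$ an ABox and $m$ a partial map from ground service calls to $\Delta$, and initial state $\langle A_0,\emptyset\rangle$. There is a transition $\langle A,m\rangle\Rightarrow\langle A',m'\rangle$, for $\langle A,m\rangle$ reachable, iff for some $\alpha\in\Gamma$ and some assignment $\sigma$ of the parameters of $\alpha$: $\sigma$ is a consistent-query answer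 over $(T,A)$ to $Q$ for some $Q\mapsto\alpha$ in $\Pi$; and, with $D$ the union of all $E\sigma\rho$ over the effects $[q^+]\wedge Q^-\rightsquigarrow E$ of $\alpha$ and the consistent-query answers $\rho$ to $([q^+]\wedge Q^-)\sigma$ over $(T,A)$, there is a total map $\theta$ from the service calls occurring in $D$ to $\Delta$, agreeing with $m$ on common arguments, such that $A'=D\theta$ and $m'=m\cup\theta$. ($A'$ need not be $T$-consistent.) The *dependency graph* of $\mathcal K$ has nodes $\langle N,1\rangle$, $\langle P,1\rangle$, $\langle P,2\rangle$ for concept names $N$ and role names $P$. For each effect $[q^+]\wedge Q^-\rightsquigarrow E$ of an action, each free variable $x$ of $q^+$ and each conjunctive query in the perfect rewriting of $q^+$ with respect to $T$ (computed by PerfectRef, which applies positive inclusions backwards to atoms and unifies atoms) in which $x$ (or the variable with which unification has identified it) occurs at node $v$: there is an ordinary edge $v\to v'$ whenever $x$ occurs as a term at node $v'$ in $E$, and a special edge $v\to v'$ whenever a service call $f(\dots,x,\dots)$ occurs at node $v'$ in $E$. $\mathcal K$ is *weakly acyclic* if no cycle of this graph goes through a special edge. **Theorem.** If $\mathcal K$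 is a weakly acyclic KAB, then $\Upsilon^{it}_{\mathcal K}$ is run-bounded: there is $b\in\mathbb N$ such that for every (finite or infinite) run $\tau$ of $\Upsilon^{it}_{\mathcal K}$ from its initial state, $\bigl|\bigcup_{\langle A,m\rangle\text{ in }\tau}\mathrm{adom}(A)\bigr|<b$. -/

import Mathlib

universe u v w x

namespace DLKAB

/-! ### Facts, atoms and positions -/

/-- A concept assertion `N(t)` or a role assertion `P(t, t')` over terms of type `τ`. -/
inductive Atom (NC : Type v) (NR : Type w) (τ : Type u) : Type (max u v w)
  | concept : NC → τ → Atom NC NR τ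
  | role : NR → τ → τ → Atom NC NR τ

/-- Replace every term of an atom. -/
def Atom.map {NC : Type v} {NR : Type w} {τ : Type u} {τ' : Type x} (f : τ → τ') :
    Atom NC NR τ → Atom NC NR τ'
  | .concept N t => .concept N (f t)
  | .role P s t => .role P (f s) (f t)

/-- Positions: `⟨N,1⟩` for a concept name, `⟨P,1⟩` and `⟨P,2⟩` for a role name. -/
inductive Position (NC : Type v) (NR : Type w) : Type (max v w)
  | concept : NC → Position NC NR
  | fst : NR → Position NC NR
  | snd : NR → Position NC NR

/-- `a.At p t`: the term `t` occurs in the atom `a` at position `p`. -/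
inductive Atom.At {NC : Type v} {NR : Type w} {τ : Type u} :
    Atom NC NR τ → Position NC NR → τ → Prop
  | concept (N : NC) (t : τ) : Atom.At (.concept N t) (.concept N) t
  | fst (P : NR) (s t : τ) : Atom.At (.role P s t) (.fst P) s
  | snd (P : NR) (s t : τ) : Atom.At (.role P s t) (.snd P) t

/-- The active domain of a set of membership assertions. -/
def adom {NC : Type v} {NR : Type w} {Δ : Type u} (A : Set (Atom NC NR Δ)) : Set Δ :=
  {d | ∃ a ∈ A, ∃ p, a.At p d}

/-! ### TBoxes -/

/-- Role expressions `P` and `P⁻`. -/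
inductive Role (NR : Type w) : Type w
  | name : NR → Role NR
  | inv : NR → Role NR

/-- The inverse of a role expression. -/
def Role.inverse {NR : Type w} : Role NR → Role NR
  | .name P => .inv P
  | .inv P => .name P

/-- Basic concepts `N` and `∃R`. -/
inductive BasicConcept (NC : Type v) (NR : Type w) : Type (max v w)
  | name : NC → BasicConcept NC NR
  | ex : Role NR → BasicConcept NC NR

/-- A DL-Lite_A TBox. Inclusions are pairs (left-hand side, right-hand side). -/
structure TBox (NC : Type v) (NR : Type w) : Type (max v w) where
  /-- positive inclusions `B₁ ⊑ B₂` -/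
  posConcept : Finset (BasicConcept NC NR × BasicConcept NC NR)
  /-- positive role inclusions `R₁ ⊑ R₂` -/
  posRole : Finset (Role NR × Role NR)
  /-- negative inclusions `B₁ ⊑ ¬B₂` -/
  negConcept : Finset (BasicConcept NC NR × BasicConcept NC NR)
  /-- negative role inclusions `R₁ ⊑ ¬R₂` -/
  negRole : Finset (Role NR × Role NR)
  /-- functionality assertions `(funct R)` -/
  funct : Finset (Role NR)
  /-- functional roles are not specialized -/
  funct_not_specialized : ∀ i ∈ posRole, i.2 ∉ funct ∧ i.2.inverse ∉ funct

/-- First-order interpretations with domain `D`; individual constants are interpreted under the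
unique name assumption. -/
structure Interp (Δ : Type u) (NC : Type v) (NR : Type w) (D : Type u) :
    Type (max u v w) where
  const : Δ → D
  const_injective : Function.Injective const
  concept : NC → Set D
  role : NR → D → D → Prop

section Semantics

variable {Δ : Type u} {NC : Type v} {NR : Type w} {D : Type u}

/-- Extension of a role expression. -/
def Interp.roleExt (I : Interp Δ NC NR D) : Role NR → D → D → Prop
  | .name P => fun d e => I.role P d e
  | .inv P => fun d e => I.role P e d

/-- Extension of a basic concept. -/
def Interp.conceptExt (I : Interp Δ NC NR D) : BasicConcept NC NR → Set D
  | .name N => I.concept N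
  | .ex R => {d | ∃ e, I.roleExt R d e}

/-- Truth of an atom over domain elements. -/
def Interp.Holds (I : Interp Δ NC NR D) : Atom NC NR D → Prop
  | .concept N d => d ∈ I.concept N
  | .role P d e => I.role P d e

/-- `I` satisfies all the assertions of the TBox `T`. -/
structure Interp.SatTBox (I : Interp Δ NC NR D) (T : TBox NC NR) : Prop where
  posConcept : ∀ i ∈ T.posConcept, ∀ d, d ∈ I.conceptExt i.1 → d ∈ I.conceptExt i.2
  posRole : ∀ i ∈ T.posRole, ∀ d e, I.roleExt i.1 d e → I.roleExt i.2 d e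
  negConcept : ∀ i ∈ T.negConcept, ∀ d, d ∈ I.conceptExt i.1 → d ∉ I.conceptExt i.2
  negRole : ∀ i ∈ T.negRole, ∀ d e, I.roleExt i.1 d e → ¬ I.roleExt i.2 d e
  funct : ∀ R ∈ T.funct, ∀ d e e', I.roleExt R d e → I.roleExt R d e' → e = e'

/-- `I` is a model of the knowledge base `(T, A)`. -/
def Interp.IsModel (I : Interp Δ NC NR D) (T : TBox NC NR) (A : Set (Atom NC NR Δ)) : Prop :=
  I.SatTBox T ∧ ∀ a ∈ A, I.Holds (a.map I.const)

/-- `A` is `T`-consistent. -/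
def Consistent (T : TBox NC NR) (A : Set (Atom NC NR Δ)) : Prop :=
  ∃ (D : Type u) (I : Interp Δ NC NR D), I.IsModel T A

/-- `A'` is a repair of `A` with `T`, i.e. a maximal `T`-consistent subset of `A`. -/
def IsRepair (T : TBox NC NR) (A A' : Set (Atom NC NR Δ)) : Prop :=
  Maximal (fun B : Set (Atom NC NR Δ) => B ⊆ A ∧ Consistent T B) A'

end Semantics

/-! ### Queries -/

/-- Terms of queries: constants and variables (variables are natural numbers). -/
inductive Term (Δ : Type u) : Type u
  | const : Δ → Term Δ
  | var : ℕ → Term Δ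

/-- Apply a substitution of variables by terms. -/
def Term.subst {Δ : Type u} (θ : ℕ → Term Δ) : Term Δ → Term Δ
  | .const c => .const c
  | .var y => θ y

/-- The value of a term in a domain. -/
def Term.eval {Δ : Type u} {D : Type x} (c : Δ → D) (μ : ℕ → D) : Term Δ → D
  | .const a => c a
  | .var y => μ y

/-- A union of conjunctive queries with the set `fv` of free variables: each disjunct is a finite
conjunction of atoms in which every free variable occurs; the other variables of the disjunct
are existentially quantified. -/
structure UCQ (Δ : Type u) (NC : Type v) (NR : Type w) : Type (max u v w) where
  fv : Finset ℕ
  disjuncts : Finset (Finset (Atom NC NR (Term Δ)))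
  safe : ∀ q ∈ disjuncts, ∀ y ∈ fv, ∃ a ∈ q, ∃ p, a.At p (.var y)

/-- The query language EQL-Lite(UCQ). -/
inductive ECQ (Δ : Type u) (NC : Type v) (NR : Type w) : Type (max u v w)
  | ucq : UCQ Δ NC NR → ECQ Δ NC NR
  | not : ECQ Δ NC NR → ECQ Δ NC NR
  | and : ECQ Δ NC NR → ECQ Δ NC NR → ECQ Δ NC NR
  | ex : ℕ → ECQ Δ NC NR → ECQ Δ NC NR

/-- Free variables of an ECQ. -/
def ECQ.fv {Δ : Type u} {NC : Type v} {NR : Type w} : ECQ Δ NC NR → Finset ℕ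
  | .ucq q => q.fv
  | .not Q => Q.fv
  | .and Q₁ Q₂ => Q₁.fv ∪ Q₂.fv
  | .ex y Q => Q.fv.erase y

section Answers

variable {Δ : Type u} {NC : Type v} {NR : Type w}

/-- The boolean query `qν` is true in the interpretation `I`. -/
def UCQ.TrueIn (q : UCQ Δ NC NR) (ν : ℕ → Δ) {D : Type u} (I : Interp Δ NC NR D) : Prop :=
  ∃ conj ∈ q.disjuncts, ∃ μ : ℕ → D, (∀ y ∈ q.fv, μ y = I.const (ν y)) ∧
    ∀ a ∈ conj, I.Holds (a.map (Term.eval I.const μ))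

/-- The boolean query `qν` is true in every model of `(T, A)`. -/
def UCQ.Certain (q : UCQ Δ NC NR) (T : TBox NC NR) (A : Set (Atom NC NR Δ)) (ν : ℕ → Δ) : Prop :=
  ∀ (D : Type u) (I : Interp Δ NC NR D), I.IsModel T A → q.TrueIn ν I

/-- The restriction of `ν` to the free variables of `q` is a consistent-query answer to `q` over
`(T, A)`. -/
def UCQ.Cqa (q : UCQ Δ NC NR) (T : TBox NC NR) (A : Set (Atom NC NR Δ)) (ν : ℕ → Δ) : Prop :=
  (∀ y ∈ q.fv, ν y ∈ adom A) ∧ ∀ A', IsRepair T A A' → q.Certain T A' ν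

/-- Composition of the consistent-query answers of UCQs through first-order constructs, with
quantifiers ranging over the active domain. -/
def ECQ.Sat (T : TBox NC NR) (A : Set (Atom NC NR Δ)) : ECQ Δ NC NR → (ℕ → Δ) → Prop
  | .ucq q, ν => q.Cqa T A ν
  | .not Q, ν => ¬ Q.Sat T A ν
  | .and Q₁ Q₂, ν => Q₁.Sat T A ν ∧ Q₂.Sat T A ν
  | .ex y Q, ν => ∃ d ∈ adom A, Q.Sat T A (Function.update ν y d)

/-- The restriction of `ν` to the free variables of `Q` is a consistent-query answer to the ECQ
`Q` over `(T, A)`. -/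
def ECQ.Cqa (Q : ECQ Δ NC NR) (T : TBox NC NR) (A : Set (Atom NC NR Δ)) (ν : ℕ → Δ) : Prop :=
  (∀ y ∈ Q.fv, ν y ∈ adom A) ∧ Q.Sat T A ν

end Answers

/-! ### Knowledge and action bases -/

/-- Terms of effects: constants, variables, and Skolem terms `f(y₁, …, yₙ)` (service calls) whose
arguments are variables. `ar` gives the arities of the service functions. -/
inductive EffTerm (Δ : Type u) {F : Type x} (ar : F → ℕ) : Type (max u x)
  | const : Δ → EffTerm Δ ar
  | var : ℕ → EffTerm Δ ar
  | call : (f : F) → (Fin (ar f) → ℕ) → EffTerm Δ ar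

/-- Ground service calls `f(d₁, …, dₙ)`. -/
abbrev ServiceCall (Δ : Type u) {F : Type x} (ar : F → ℕ) : Type (max u x) :=
  (f : F) × (Fin (ar f) → Δ)

/-- Ground an effect term; the result is a constant or a ground service call. -/
def EffTerm.ground {Δ : Type u} {F : Type x} {ar : F → ℕ} (ν : ℕ → Δ) :
    EffTerm Δ ar → Δ ⊕ ServiceCall Δ ar
  | .const c => .inl c
  | .var y => .inl (ν y)
  | .call f ys => .inr ⟨f, fun i => ν (ys i)⟩

/-- The variables of an effect term. -/
def EffTerm.vars {Δ : Type u} {F : Type x} {ar : F → ℕ} : EffTerm Δ ar → Set ℕ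
  | .const _ => ∅
  | .var y => {y}
  | .call _ ys => Set.range ys

/-- An effect `[q⁺] ∧ Q⁻ ⇝ E`. -/
structure Effect (Δ : Type u) (NC : Type v) (NR : Type w) {F : Type x} (ar : F → ℕ) :
    Type (max u v w x) where
  qpos : UCQ Δ NC NR
  Qneg : ECQ Δ NC NR
  facts : Finset (Atom NC NR (EffTerm Δ ar))
  fv_Qneg : Qneg.fv ⊆ qpos.fv
  fv_facts : ∀ a ∈ facts, ∀ p t, a.At p t → ∀ y ∈ t.vars, y ∈ qpos.fv

/-- An action: a finite set of input parameters (which may occur as free variables in the effects)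
and a finite set of effects. -/
structure Action (Δ : Type u) (NC : Type v) (NR : Type w) {F : Type x} (ar : F → ℕ) :
    Type (max u v w x) where
  params : Finset ℕ
  effects : Finset (Effect Δ NC NR ar)

/-- A condition-action rule `Q ↦ α`; the free variables of `Q` are the parameters of `α`. -/
structure Rule (Δ : Type u) (NC : Type v) (NR : Type w) {F : Type x} (ar : F → ℕ) :
    Type (max u v w x) where
  cond : ECQ Δ NC NR
  action : Action Δ NC NR ar
  fv_cond : cond.fv = action.params

/-- A knowledge and action base `(T, A₀, Γ, Π)`. -/
structure KAB (Δ : Type u) (NC : Type v) (NR : Type w) {F : Type x} (ar : F → ℕ) :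
    Type (max u v w x) where
  tbox : TBox NC NR
  abox₀ : Finset (Atom NC NR Δ)
  actions : Finset (Action Δ NC NR ar)
  process : Finset (Rule Δ NC NR ar)
  consistent₀ : Consistent tbox (abox₀ : Set (Atom NC NR Δ))
  process_actions : ∀ r ∈ process, r.action ∈ actions
  effect_consts : ∀ α ∈ actions, ∀ e ∈ α.effects, ∀ a ∈ e.facts, ∀ p c,
    a.At p (EffTerm.const c) → c ∈ adom (abox₀ : Set (Atom NC NR Δ))

/-! ### Transition systems and run-boundedness -/

/-- Transition systems whose states are labelled by ABoxes. -/
structure TransitionSystem (Δ : Type u) (NC : Type v) (NR : Type w) (S : Type x) :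
    Type (max u v w x) where
  tbox : TBox NC NR
  states : Set S
  init : S
  abox : S → Set (Atom NC NR Δ)
  trans : S → S → Prop

/-- `τ 0, τ 1, …` with `L` states (`L = ⊤` for an infinite one) is a run from the initial state. -/
def TransitionSystem.IsRun {Δ : Type u} {NC : Type v} {NR : Type w} {S : Type x}
    (Υ : TransitionSystem Δ NC NR S) (τ : ℕ → S) (L : ℕ∞) : Prop :=
  0 < L ∧ τ 0 = Υ.init ∧ ∀ i : ℕ, ((i + 1 : ℕ) : ℕ∞) < L → Υ.trans (τ i) (τ (i + 1))

/-- There is a bound `b` such that along every run fewer than `b` values occur. -/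
def TransitionSystem.RunBounded {Δ : Type u} {NC : Type v} {NR : Type w} {S : Type x}
    (Υ : TransitionSystem Δ NC NR S) : Prop :=
  ∃ b : ℕ, ∀ (τ : ℕ → S) (L : ℕ∞), Υ.IsRun τ L →
    (⋃ i ∈ {i : ℕ | (i : ℕ∞) < L}, adom (Υ.abox (τ i))).encard < (b : ℕ∞)

section Execution

variable {Δ : Type u} {NC : Type v} {NR : Type w} {F : Type x} {ar : F → ℕ}

/-- States: an ABox and a service call map (a partial function from service calls to values). -/
structure State (Δ : Type u) (NC : Type v) (NR : Type w) {F : Type x} (ar : F → ℕ) :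
    Type (max u v w x) where
  abox : Set (Atom NC NR Δ)
  calls : ServiceCall Δ ar → Option Δ

/-- The set of facts, possibly with service calls, obtained by evaluating under consistent query
answering the effects of `α` with parameter assignment `σ` (of which only the restriction to the
parameters is used) over `A`. -/
def doEffects (T : TBox NC NR) (A : Set (Atom NC NR Δ)) (α : Action Δ NC NR ar) (σ : ℕ → Δ) :
    Set (Atom NC NR (Δ ⊕ ServiceCall Δ ar)) :=
  {g | ∃ e ∈ α.effects, ∃ ν : ℕ → Δ, (∀ y ∈ α.params, ν y = σ y) ∧
    (ECQ.and (.ucq e.qpos) e.Qneg).Cqa T A ν ∧ ∃ a ∈ e.facts, g = a.map (EffTerm.ground ν)}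

/-- The service calls occurring in a set of facts. -/
def skolems (E : Set (Atom NC NR (Δ ⊕ ServiceCall Δ ar))) : Set (ServiceCall Δ ar) :=
  {c | ∃ g ∈ E, ∃ p, g.At p (.inr c)}

/-- `σ` is a legal parameter assignment for `α` over `A`. -/
def KAB.Legal (K : KAB Δ NC NR ar) (A : Set (Atom NC NR Δ)) (α : Action Δ NC NR ar)
    (σ : ℕ → Δ) : Prop :=
  ∃ r ∈ K.process, r.action = α ∧ r.cond.Cqa K.tbox A σ

open Classical in
/-- The execution relation under the inconsistency-tolerant semantics: no consistency condition is
imposed on the resulting ABox. The evaluation `θ` of the service calls is used only on the calls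
that occur in the facts produced by the action. -/
def KAB.Exec (K : KAB Δ NC NR ar) (s : State Δ NC NR ar) (α : Action Δ NC NR ar) (σ : ℕ → Δ)
    (s' : State Δ NC NR ar) : Prop :=
  K.Legal s.abox α σ ∧ ∃ θ : ServiceCall Δ ar → Δ,
    (∀ c ∈ skolems (doEffects K.tbox s.abox α σ), ∀ d, s.calls c = some d → θ c = d) ∧
    s'.abox = Atom.map (Sum.elim id θ) '' doEffects K.tbox s.abox α σ ∧
    s'.calls = fun c =>
      if c ∈ skolems (doEffects K.tbox s.abox α σ) then some (θ c) else s.calls c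

/-- The initial state `⟨A₀, ∅⟩`. -/
def KAB.initState (K : KAB Δ NC NR ar) : State Δ NC NR ar where
  abox := (K.abox₀ : Set (Atom NC NR Δ))
  calls := fun _ => none

/-- The states of the inconsistency-tolerant transition system. -/
inductive KAB.ItReachable (K : KAB Δ NC NR ar) : State Δ NC NR ar → Prop
  | init : K.ItReachable K.initState
  | step {s s' : State Δ NC NR ar} {α : Action Δ NC NR ar} {σ : ℕ → Δ} :
      K.ItReachable s → α ∈ K.actions → K.Exec s α σ s' → K.ItReachable s'

/-- The transition system of `K` under the inconsistency-tolerant semantics. -/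
def KAB.itTS (K : KAB Δ NC NR ar) : TransitionSystem Δ NC NR (State Δ NC NR ar) where
  tbox := K.tbox
  states := {s | K.ItReachable s}
  init := K.initState
  abox := State.abox
  trans := fun s s' => K.ItReachable s ∧ ∃ α ∈ K.actions, ∃ σ : ℕ → Δ, K.Exec s α σ s'

end Execution

/-! ### Perfect rewriting -/

/-- The atom `R(s, t)` for a role expression `R`. -/
def Role.atom {NR : Type w} (NC : Type v) {τ : Type u} : Role NR → τ → τ → Atom NC NR τ
  | .name P, s, t => .role P s t
  | .inv P, s, t => .role P t s

/-- The atom expressing that `t` belongs to a basic concept; `t'` is the second argument in the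
case of `∃R`. -/
def BasicConcept.atom {NC : Type v} {NR : Type w} {τ : Type u} :
    BasicConcept NC NR → τ → τ → Atom NC NR τ
  | .name N, t, _ => .concept N t
  | .ex R, t, t' => R.atom NC t t'

/-- A conjunctive query with answer variables `X` as handled by the rewriting algorithm: unification
may replace an answer variable by another variable or a constant, so the head of the query records
the term which each answer variable stands for. -/
structure CQ (Δ : Type u) (NC : Type v) (NR : Type w) (X : Finset ℕ) : Type (max u v w) where
  head : {y // y ∈ X} → Term Δ
  body : Set (Atom NC NR (Term Δ))

section Rewriting

variable {Δ : Type u} {NC : Type v} {NR : Type w} {X : Finset ℕ}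

/-- The variable `z` is distinguished, i.e. occurs in the head. -/
def CQ.Distinguished (q : CQ Δ NC NR X) (z : ℕ) : Prop := ∃ y, q.head y = .var z

/-- The variable `z` does not occur in `q`. -/
def CQ.Fresh (q : CQ Δ NC NR X) (z : ℕ) : Prop :=
  ¬ q.Distinguished z ∧ ∀ g ∈ q.body, ∀ p, ¬ g.At p (.var z)

/-- The variable `z` is unbound in `q`, where `R(t, z)` is an atom of `q`: it is not distinguished
and this is its only occurrence in the body. -/
def CQ.UnboundIn (q : CQ Δ NC NR X) (R : Role NR) (t : Term Δ) (z : ℕ) : Prop :=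
  ¬ q.Distinguished z ∧ t ≠ .var z ∧
    ∀ g ∈ q.body, g ≠ R.atom NC t (.var z) → ∀ p, ¬ g.At p (.var z)

/-- Replace the atom `g` by `g'`. -/
def CQ.replace (q : CQ Δ NC NR X) (g g' : Atom NC NR (Term Δ)) : CQ Δ NC NR X where
  head := q.head
  body := insert g' (q.body \ {g})

/-- Apply a substitution to head and body. -/
def CQ.subst (q : CQ Δ NC NR X) (θ : ℕ → Term Δ) : CQ Δ NC NR X where
  head := fun y => (q.head y).subst θ
  body := Atom.map (Term.subst θ) '' q.body

/-- `θ` is a most general unifier of the atoms `g₁` and `g₂`. -/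
def IsMGU (θ : ℕ → Term Δ) (g₁ g₂ : Atom NC NR (Term Δ)) : Prop :=
  g₁.map (Term.subst θ) = g₂.map (Term.subst θ) ∧
    ∀ η : ℕ → Term Δ, g₁.map (Term.subst η) = g₂.map (Term.subst η) →
      ∃ κ : ℕ → Term Δ, ∀ y, η y = (θ y).subst κ

/-- One step of the algorithm PerfectRef with respect to the positive inclusions of `T`: a positive
inclusion is applied from right to left to an atom, or two atoms are unified. -/
inductive RewStep (T : TBox NC NR) : CQ Δ NC NR X → CQ Δ NC NR X → Prop
  | conceptName (q : CQ Δ NC NR X) (B : BasicConcept NC NR) (N : NC) (t : Term Δ) (z : ℕ) :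
      (B, .name N) ∈ T.posConcept → .concept N t ∈ q.body → q.Fresh z →
      RewStep T q (q.replace (.concept N t) (B.atom t (.var z)))
  | conceptEx (q : CQ Δ NC NR X) (B : BasicConcept NC NR) (R : Role NR) (t : Term Δ) (y z : ℕ) :
      (B, .ex R) ∈ T.posConcept → R.atom NC t (.var y) ∈ q.body → q.UnboundIn R t y → q.Fresh z →
      RewStep T q (q.replace (R.atom NC t (.var y)) (B.atom t (.var z)))
  | role (q : CQ Δ NC NR X) (R R' : Role NR) (s t : Term Δ) :
      (R, R') ∈ T.posRole → R'.atom NC s t ∈ q.body →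
      RewStep T q (q.replace (R'.atom NC s t) (R.atom NC s t))
  | reduce (q : CQ Δ NC NR X) (g₁ g₂ : Atom NC NR (Term Δ)) (θ : ℕ → Term Δ) :
      g₁ ∈ q.body → g₂ ∈ q.body → g₁ ≠ g₂ → IsMGU θ g₁ g₂ → RewStep T q (q.subst θ)

/-- The perfect rewriting of `q` with respect to `T`: the conjunctive queries (up to renaming,
finitely many) obtained from the disjuncts of `q` by the steps of PerfectRef. -/
def UCQ.rew (q : UCQ Δ NC NR) (T : TBox NC NR) : Set (CQ Δ NC NR q.fv) :=
  {q' | ∃ conj ∈ q.disjuncts,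
    Relation.ReflTransGen (RewStep T) ⟨fun y => .var y, (conj : Set (Atom NC NR (Term Δ)))⟩ q'}

/-- The answer variable `y` occurs in `q` at position `p`. -/
def CQ.AnswerVarAt (q : CQ Δ NC NR X) (y : {y // y ∈ X}) (p : Position NC NR) : Prop :=
  ∃ z, q.head y = .var z ∧ ∃ g ∈ q.body, g.At p (.var z)

end Rewriting

/-! ### Weak acyclicity -/

section WeakAcyclicity

variable {Δ : Type u} {NC : Type v} {NR : Type w} {F : Type x} {ar : F → ℕ}

/-- Ordinary edges of the dependency graph. -/
def KAB.OrdinaryEdge (K : KAB Δ NC NR ar) (p₁ p₂ : Position NC NR) : Prop :=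
  ∃ α ∈ K.actions, ∃ e ∈ α.effects, ∃ y : {y // y ∈ e.qpos.fv},
    (∃ q ∈ e.qpos.rew K.tbox, q.AnswerVarAt y p₁) ∧
    ∃ a ∈ e.facts, a.At p₂ (.var y)

/-- Special edges of the dependency graph. -/
def KAB.SpecialEdge (K : KAB Δ NC NR ar) (p₁ p₂ : Position NC NR) : Prop :=
  ∃ α ∈ K.actions, ∃ e ∈ α.effects, ∃ y : {y // y ∈ e.qpos.fv},
    (∃ q ∈ e.qpos.rew K.tbox, q.AnswerVarAt y p₁) ∧
    ∃ a ∈ e.facts, ∃ (f : F) (ys : Fin (ar f) → ℕ),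
      a.At p₂ (.call f ys) ∧ (y : ℕ) ∈ Set.range ys

/-- The dependency graph has no cycle going through a special edge. -/
def KAB.WeaklyAcyclic (K : KAB Δ NC NR ar) : Prop :=
  ∀ p₁ p₂, K.SpecialEdge p₁ p₂ →
    ¬ Relation.ReflTransGen (fun p p' => K.OrdinaryEdge p p' ∨ K.SpecialEdge p p') p₂ p₁

end WeakAcyclicity

end DLKAB

/-! Call a position u prior to p if some path from u to p in the dependency graph uses a special
edge. Weak acyclicity says that this transitive relation is irreflexive. Only finitely many
positions ever carry values, so the relation is well-founded on them, and the number of values at p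
along a run is bounded by induction on p. A value at p is a base value (a constant of the initial
ABox or of an effect query), a value moved along an ordinary edge, or the result of a service call.
Tracing ordinary edges back in time (`runValues_subset`), it is a base value or the result of a call
whose arguments are base values or values at prior positions. A call returns a single value along a
run, so counting argument tuples gives a bound that does not depend on the run.

This needs to know where answers come from: a value of an answer variable of q⁺ must be a constant
of the query or occur in the ABox at a position of that variable in the perfect rewriting
(`UCQ.Cqa.value_cases`). A consistent-query answer is certain over some repair, hence true in the
canonical model of that repair (`chaseInterp_isModel`). Completeness of PerfectRef
(`CQ.Match.exists_rewriting`) turns the match in the canonical model into a match of a rewritten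
query in the repair, which is a subset of the ABox. The query Q⁻ and the rule conditions only filter
answers and play no part in the bound. -/

namespace DLKAB

/-! ### Atoms under maps of terms, and truth of role and basic-concept atoms. -/

section Basics

variable {Δ : Type u} {NC : Type v} {NR : Type w} {D : Type u}

theorem Atom.map_map {τ τ' τ'' : Type*} (f : τ → τ') (g : τ' → τ'') (a : Atom NC NR τ) :
    (a.map f).map g = a.map (fun t => g (f t)) := by
  cases a <;> rfl

theorem Atom.at_map {τ τ' : Type*} {f : τ → τ'} {a : Atom NC NR τ} {p : Position NC NR} {d : τ'} :
    (a.map f).At p d ↔ ∃ t, a.At p t ∧ f t = d := by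
  constructor
  · intro h
    cases a with
    | concept N t => cases h; exact ⟨_, .concept _ _, rfl⟩
    | role P s t =>
      cases h
      · exact ⟨_, .fst _ _ _, rfl⟩
      · exact ⟨_, .snd _ _ _, rfl⟩
  · rintro ⟨t, h, rfl⟩
    cases h
    · exact .concept _ _
    · exact .fst _ _ _
    · exact .snd _ _ _

theorem Atom.map_congr {τ τ' : Type*} {f g : τ → τ'} {a : Atom NC NR τ}
    (h : ∀ p t, a.At p t → f t = g t) : a.map f = a.map g := by
  cases a with
  | concept N t => simp only [Atom.map, h _ _ (.concept N t)]
  | role P s t => simp only [Atom.map, h _ _ (.fst P s t), h _ _ (.snd P s t)]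

theorem Role.inverse_inverse (R : Role NR) : R.inverse.inverse = R := by cases R <;> rfl

theorem Role.atom_inverse {τ : Type*} (R : Role NR) (s t : τ) :
    R.inverse.atom NC s t = R.atom NC t s := by
  cases R <;> rfl

theorem Role.map_atom {τ τ' : Type*} (f : τ → τ') (R : Role NR) (s t : τ) :
    (R.atom NC s t).map f = R.atom NC (f s) (f t) := by
  cases R <;> rfl

theorem BasicConcept.map_atom {τ τ' : Type*} (f : τ → τ') (B : BasicConcept NC NR) (s t : τ) :
    (B.atom s t).map f = B.atom (f s) (f t) := by
  cases B
  · rfl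
  · exact Role.map_atom _ _ _ _

theorem Role.map_eq_atom {τ τ' : Type*} {f : τ → τ'} {R : Role NR} {g : Atom NC NR τ} {d e : τ'}
    (h : g.map f = R.atom NC d e) : ∃ s t, g = R.atom NC s t ∧ f s = d ∧ f t = e := by
  cases R <;> cases g <;> simp only [Atom.map, Role.atom, Atom.role.injEq, reduceCtorEq] at h
  · obtain ⟨rfl, h1, h2⟩ := h; exact ⟨_, _, rfl, h1, h2⟩
  · obtain ⟨rfl, h1, h2⟩ := h; exact ⟨_, _, rfl, h2, h1⟩

theorem Role.at_atom {τ : Type*} {R : Role NR} {s t r : τ} {p : Position NC NR}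
    (h : (R.atom NC s t).At p r) : r = s ∨ r = t := by
  cases R <;> cases h <;> simp

theorem Role.atom_at_left {τ : Type*} (R : Role NR) (s t : τ) :
    ∃ p, (R.atom NC s t).At p s := by
  cases R
  · exact ⟨_, .fst _ _ _⟩
  · exact ⟨_, .snd _ _ _⟩

theorem Role.atom_at_right {τ : Type*} (R : Role NR) (s t : τ) :
    ∃ p, (R.atom NC s t).At p t := by
  cases R
  · exact ⟨_, .snd _ _ _⟩
  · exact ⟨_, .fst _ _ _⟩

theorem BasicConcept.at_atom {τ : Type*} {B : BasicConcept NC NR} {s t r : τ}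
    {p : Position NC NR} (h : (B.atom s t).At p r) : r = s ∨ r = t := by
  cases B
  · cases h; simp
  · exact Role.at_atom h

theorem BasicConcept.atom_at_left {τ : Type*} (B : BasicConcept NC NR) (s t : τ) :
    ∃ p, (B.atom s t).At p s := by
  cases B
  · exact ⟨_, .concept _ _⟩
  · exact Role.atom_at_left _ _ _

theorem Interp.holds_role_atom (I : Interp Δ NC NR D) (R : Role NR) (d e : D) :
    I.Holds (R.atom NC d e) ↔ I.roleExt R d e := by
  cases R <;> rfl

/-- Lets N and ∃R be treated alike: for a concept name the second argument of `B.atom` is a dummy.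
-/
theorem Interp.mem_conceptExt_iff (I : Interp Δ NC NR D) (B : BasicConcept NC NR) (d : D) :
    d ∈ I.conceptExt B ↔ ∃ e, I.Holds (B.atom d e) := by
  cases B with
  | name N => exact ⟨fun h => ⟨d, h⟩, fun ⟨_, h⟩ => h⟩
  | ex R => exact exists_congr fun e => (I.holds_role_atom R d e).symm

theorem Role.atom_eq_atom {τ : Type*} {R R' : Role NR} {d e d' e' : τ}
    (h : R.atom NC d e = R'.atom NC d' e') :
    R = R' ∧ d = d' ∧ e = e' ∨ R = R'.inverse ∧ d = e' ∧ e = d' := by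
  cases R <;> cases R' <;> simp only [Role.atom, Atom.role.injEq] at h <;>
    simp [Role.inverse, h]

end Basics

/-! ### The canonical model -/

section Chase

variable {Δ : Type u} {NC : Type v} {NR : Type w}

/-- Elements of the canonical model: a constant followed by the codes of the roles through which
successors have been introduced, the last one first. -/
abbrev Null (Δ : Type u) : Type u := Δ × List ℕ

/-- The successor of `d` introduced for the role `R`. -/
def Null.child (f : Role NR → ℕ) (d : Null Δ) (R : Role NR) : Null Δ := (d.1, f R :: d.2)

/-- The element has an `R`-successor in the ABox, or its predecessor is an `R`-successor. -/
def Blocked (A : Set (Atom NC NR Δ)) (f : Role NR → ℕ) (R : Role NR) : Null Δ → Prop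
  | (c, []) => ∃ c', R.atom NC c c' ∈ A
  | (_, k :: _) => k = f R.inverse

/-- Facts derivable from `A` by the positive inclusions of `T` in the given number of steps; for
functional roles a new successor is introduced only if there is none yet. -/
inductive Chase (T : TBox NC NR) (A : Set (Atom NC NR Δ)) (f : Role NR → ℕ) :
    ℕ → Atom NC NR (Null Δ) → Prop
  | base (a : Atom NC NR Δ) : a ∈ A → Chase T A f 0 (a.map fun c => (c, []))
  | concept (n : ℕ) (B : BasicConcept NC NR) (N : NC) (d e : Null Δ) :
      (B, .name N) ∈ T.posConcept → Chase T A f n (B.atom d e) →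
      Chase T A f (n + 1) (.concept N d)
  | exist (n : ℕ) (B : BasicConcept NC NR) (R : Role NR) (d e : Null Δ) :
      (B, .ex R) ∈ T.posConcept → Chase T A f n (B.atom d e) →
      (R ∈ T.funct → ¬ Blocked A f R d) →
      Chase T A f (n + 1) (R.atom NC d (d.child f R))
  | role (n : ℕ) (R R' : Role NR) (d e : Null Δ) :
      (R, R') ∈ T.posRole → Chase T A f n (R.atom NC d e) →
      Chase T A f (n + 1) (R'.atom NC d e)

/-- The roles for which successors are introduced. -/
def TBox.genRoles (T : TBox NC NR) : Set (Role NR) :=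
  {R | ∃ B, (B, BasicConcept.ex R) ∈ T.posConcept}

/-- `f` separates the roles for which successors are introduced and their inverses. -/
def TBox.Coding (T : TBox NC NR) (f : Role NR → ℕ) : Prop :=
  Set.InjOn f (T.genRoles ∪ Role.inverse '' T.genRoles)

/-- Only finitely many roles head an existential inclusion. Coding them by numbers keeps the
elements of the canonical model in the universe of Δ, where domains of interpretations must live.
Inverses are coded too because `Blocked` compares codes with `f R.inverse`. -/
theorem TBox.exists_coding (T : TBox NC NR) : ∃ f : Role NR → ℕ, T.Coding f := by
  have h : T.genRoles.Finite := by
    have h1 : (Prod.snd '' (T.posConcept : Set (BasicConcept NC NR × BasicConcept NC NR))).Finite :=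
      T.posConcept.finite_toSet.image _
    refine Set.Finite.of_injOn (f := BasicConcept.ex) ?_ ?_ h1
    · rintro R ⟨B, hB⟩
      exact ⟨_, hB, rfl⟩
    · intro a _ b _ hab
      exact BasicConcept.ex.inj hab
  exact Set.countable_iff_exists_injOn.1 (h.union (h.image _)).countable

variable {T : TBox NC NR} {A : Set (Atom NC NR Δ)} {f : Role NR → ℕ}

/-- The fact that introduces an element is derived before all other facts on this element. -/
theorem Chase.exists_creation {n : ℕ} {a : Atom NC NR (Null Δ)} (h : Chase T A f n a)
    {p : Position NC NR} {c : Δ} {k : ℕ} {l : List ℕ} (hp : a.At p (c, k :: l)) :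
    ∃ R ∈ T.genRoles, f R = k ∧ ∃ m, Chase T A f m (R.atom NC (c, l) (c, k :: l)) ∧
      (m < n ∨ a = R.atom NC (c, l) (c, k :: l)) := by
  induction h generalizing p c k l with
  | base a ha =>
    obtain ⟨t, -, ht⟩ := Atom.at_map.1 hp
    simp at ht
  | concept n B N d e hB h ih =>
    cases hp
    obtain ⟨p, hp⟩ := BasicConcept.atom_at_left B (c, k :: l) e
    obtain ⟨R, hR, hf, m, hm, hmn⟩ := ih hp
    refine ⟨R, hR, hf, ?_⟩
    rcases hmn with hmn | hmn
    · exact ⟨m, hm, .inl (by omega)⟩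
    · exact ⟨n, hmn ▸ h, .inl (by omega)⟩
  | exist n B R d e hB h hbl ih =>
    rcases Role.at_atom hp with rfl | hd
    · obtain ⟨p, hp⟩ := BasicConcept.atom_at_left B (c, k :: l) e
      obtain ⟨R, hR, hf, m, hm, hmn⟩ := ih hp
      refine ⟨R, hR, hf, ?_⟩
      rcases hmn with hmn | hmn
      · exact ⟨m, hm, .inl (by omega)⟩
      · exact ⟨n, hmn ▸ h, .inl (by omega)⟩
    · obtain ⟨c', l'⟩ := d
      simp only [Null.child, Prod.mk.injEq, List.cons.injEq] at hd
      obtain ⟨rfl, rfl, rfl⟩ := hd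
      exact ⟨R, ⟨B, hB⟩, rfl, n + 1, .exist n B R _ e hB h hbl, .inr rfl⟩
  | role n R R' d e hR h ih =>
    have : ∃ p, (R.atom NC d e).At p (c, k :: l) := by
      rcases Role.at_atom hp with hd | hd
      · exact hd ▸ Role.atom_at_left _ _ _
      · exact hd ▸ Role.atom_at_right _ _ _
    obtain ⟨p, hp⟩ := this
    obtain ⟨S, hS, hf, m, hm, hmn⟩ := ih hp
    refine ⟨S, hS, hf, ?_⟩
    rcases hmn with hmn | hmn
    · exact ⟨m, hm, .inl (by omega)⟩
    · exact ⟨n, hmn ▸ h, .inl (by omega)⟩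

/-- The canonical interpretation. -/
def chaseInterp (T : TBox NC NR) (A : Set (Atom NC NR Δ)) (f : Role NR → ℕ) :
    Interp Δ NC NR (Null Δ) where
  const c := (c, [])
  const_injective _ _ h := (Prod.mk.inj h).1
  concept N := {d | ∃ n, Chase T A f n (.concept N d)}
  role P d e := ∃ n, Chase T A f n (.role P d e)

theorem chaseInterp_holds (a : Atom NC NR (Null Δ)) :
    (chaseInterp T A f).Holds a ↔ ∃ n, Chase T A f n a := by
  cases a <;> rfl

theorem chaseInterp_roleExt (R : Role NR) (d e : Null Δ) :
    (chaseInterp T A f).roleExt R d e ↔ ∃ n, Chase T A f n (R.atom NC d e) := by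
  rw [← Interp.holds_role_atom, chaseInterp_holds]

theorem mem_chaseInterp_conceptExt (B : BasicConcept NC NR) (d : Null Δ) :
    d ∈ (chaseInterp T A f).conceptExt B ↔ ∃ e n, Chase T A f n (B.atom d e) := by
  simp only [Interp.mem_conceptExt_iff, chaseInterp_holds]

open Classical in
/-- The homomorphism from the canonical interpretation to a model, with the constants and the codes
given separately. -/
noncomputable def chaseHom {D : Type u} (I : Interp Δ NC NR D) (T : TBox NC NR) (f : Role NR → ℕ)
    (c : Δ) : List ℕ → D
  | [] => I.const c
  | k :: l =>
    if h : ∃ e, ∃ R ∈ T.genRoles, f R = k ∧ I.roleExt R (chaseHom I T f c l) e then h.choose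
    else I.const c

/-- The successor chosen by `chaseHom` could a priori belong to another role with the same code;
injectivity of the coding excludes this. The default value of `chaseHom` is not reached here. -/
theorem chaseHom_child {D : Type u} {I : Interp Δ NC NR D} (hf : T.Coding f) {c : Δ} {l : List ℕ}
    {R : Role NR} (hR : R ∈ T.genRoles) (h : ∃ e, I.roleExt R (chaseHom I T f c l) e) :
    I.roleExt R (chaseHom I T f c l) (chaseHom I T f c (f R :: l)) := by
  obtain ⟨e, he⟩ := h
  have h' : ∃ e, ∃ S ∈ T.genRoles, f S = f R ∧ I.roleExt S (chaseHom I T f c l) e :=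
    ⟨e, R, hR, rfl, he⟩
  rw [chaseHom, dif_pos h']
  obtain ⟨S, hS, hSR, hh⟩ := h'.choose_spec
  obtain rfl := hf (.inl hS) (.inl hR) hSR
  exact hh

theorem Chase.holds_hom {D : Type u} {I : Interp Δ NC NR D} (hI : I.IsModel T A)
    (hf : T.Coding f) {n : ℕ} {a : Atom NC NR (Null Δ)} (h : Chase T A f n a) :
    I.Holds (a.map fun d => chaseHom I T f d.1 d.2) := by
  induction h with
  | base a ha =>
    rw [Atom.map_map]
    exact hI.2 a ha
  | concept n B N d e hB h ih =>
    rw [BasicConcept.map_atom] at ih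
    exact hI.1.posConcept _ hB _ ((I.mem_conceptExt_iff _ _).2 ⟨_, ih⟩)
  | exist n B R d e hB h hbl ih =>
    rw [BasicConcept.map_atom] at ih
    rw [Role.map_atom, Interp.holds_role_atom]
    exact chaseHom_child hf ⟨B, hB⟩
      (hI.1.posConcept _ hB _ ((I.mem_conceptExt_iff _ _).2 ⟨_, ih⟩))
  | role n R R' d e hR h ih =>
    rw [Role.map_atom, Interp.holds_role_atom] at ih ⊢
    exact hI.1.posRole _ hR _ _ ih

/-- Neither a functional role nor its inverse is the right-hand side of a role inclusion, so its
atoms come only from the ABox or from the creation of an element, which is then the second argument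
or, for the inverse role, the first. This is why `Blocked` can look at the ABox and the name of the
element alone instead of the facts derived so far. -/
theorem Chase.funct_cases {n : ℕ} {R : Role NR} {d e : Null Δ} (hR : R ∈ T.funct)
    (h : Chase T A f n (R.atom NC d e)) :
    (∃ c c', d = (c, []) ∧ e = (c', []) ∧ R.atom NC c c' ∈ A) ∨
      (e = d.child f R ∧ ¬ Blocked A f R d) ∨ d = e.child f R.inverse := by
  generalize ha : R.atom NC d e = a at h
  cases h with
  | base a' h' =>
    obtain ⟨s, t, rfl, rfl, rfl⟩ := Role.map_eq_atom ha.symm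
    exact .inl ⟨s, t, rfl, rfl, h'⟩
  | concept => cases R <;> cases ha
  | exist n B S d' e' hB h hbl =>
    rcases Role.atom_eq_atom ha with ⟨rfl, rfl, rfl⟩ | ⟨rfl, rfl, rfl⟩
    · exact .inr (.inl ⟨rfl, hbl hR⟩)
    · rw [Role.inverse_inverse]
      exact .inr (.inr rfl)
  | role n S S' d' e' hS h =>
    have := T.funct_not_specialized _ hS
    rcases Role.atom_eq_atom ha with ⟨rfl, -, -⟩ | ⟨rfl, -, -⟩
    · exact absurd hR this.1
    · exact absurd hR this.2

theorem blocked_child (R : Role NR) (e : Null Δ) : Blocked A f R (e.child f R.inverse) := rfl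

/-- Positive inclusions hold by construction. Negative ones hold because a violation would be
carried by the homomorphism into a given model. Functionality holds because an element has one child
per role code and is given none when it is blocked. -/
theorem chaseInterp_isModel (hA : Consistent T A) (hf : T.Coding f) :
    (chaseInterp T A f).IsModel T A := by
  obtain ⟨D, I, hI⟩ := hA
  have hom : ∀ a, (chaseInterp T A f).Holds a →
      I.Holds (a.map fun d => chaseHom I T f d.1 d.2) := fun a ha =>
    let ⟨_, h⟩ := (chaseInterp_holds a).1 ha
    h.holds_hom hI hf
  have homC : ∀ B d, d ∈ (chaseInterp T A f).conceptExt B →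
      chaseHom I T f d.1 d.2 ∈ I.conceptExt B := by
    intro B d h
    obtain ⟨e, he⟩ := (Interp.mem_conceptExt_iff _ _ _).1 h
    have := hom _ he
    rw [BasicConcept.map_atom] at this
    exact (I.mem_conceptExt_iff _ _).2 ⟨_, this⟩
  have homR : ∀ R d e, (chaseInterp T A f).roleExt R d e →
      I.roleExt R (chaseHom I T f d.1 d.2) (chaseHom I T f e.1 e.2) := by
    intro R d e h
    have := hom _ ((Interp.holds_role_atom _ _ _ _).2 h)
    rwa [Role.map_atom, Interp.holds_role_atom] at this
  refine ⟨⟨?_, ?_, ?_, ?_, ?_⟩, fun a ha => (chaseInterp_holds _).2 ⟨0, .base a ha⟩⟩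
  · rintro ⟨B, B'⟩ hi d hd
    obtain ⟨e, n, h⟩ := (mem_chaseInterp_conceptExt B d).1 hd
    refine (mem_chaseInterp_conceptExt B' d).2 ?_
    cases B' with
    | name N => exact ⟨d, n + 1, .concept n B N d e hi h⟩
    | ex R =>
      -- If creation is blocked, a successor exists already: in the ABox when `d` is a constant, and
      -- otherwise the parent of `d`, since `d` was created for `R.inverse`.
      by_cases hb : R ∈ T.funct → ¬ Blocked A f R d
      · exact ⟨_, n + 1, .exist n B R d e hi h hb⟩
      · push Not at hb
        obtain ⟨-, hb⟩ := hb
        obtain ⟨c, _ | ⟨k, l⟩⟩ := d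
        · obtain ⟨c', hc⟩ := hb
          refine ⟨(c', []), 0, ?_⟩
          have := Chase.base (T := T) (f := f) _ hc
          rwa [Role.map_atom] at this
        · obtain ⟨p, hp⟩ := BasicConcept.atom_at_left B (c, k :: l) e
          obtain ⟨S, hS, hSk, m, hm, -⟩ := h.exists_creation hp
          have hk : k = f R.inverse := hb
          obtain rfl := hf (.inl hS) (.inr ⟨R, ⟨B, hi⟩, rfl⟩) (hSk.trans hk)
          refine ⟨(c, l), m, ?_⟩
          rwa [Role.atom_inverse] at hm
  · rintro ⟨R, R'⟩ hi d e h
    obtain ⟨n, hn⟩ := (chaseInterp_roleExt _ _ _).1 h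
    exact (chaseInterp_roleExt _ _ _).2 ⟨n + 1, .role n R R' d e hi hn⟩
  · exact fun i hi d h1 h2 => hI.1.negConcept i hi _ (homC _ _ h1) (homC _ _ h2)
  · exact fun i hi d e h1 h2 => hI.1.negRole i hi _ _ (homR _ _ _ h1) (homR _ _ _ h2)
  · intro R hR d e e' h h'
    have hc := homR _ _ _ h
    have hc' := homR _ _ _ h'
    obtain ⟨n, hn⟩ := (chaseInterp_roleExt _ _ _).1 h
    obtain ⟨n', hn'⟩ := (chaseInterp_roleExt _ _ _).1 h'
    -- Two ABox successors agree by functionality in the given model and unique names; two children,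
    -- or two parents, have equal names; mixed cases contradict blocking or the shape of the names.
    rcases hn.funct_cases hR with ⟨c, c₁, rfl, rfl, h1⟩ | ⟨rfl, h1⟩ | rfl <;>
      rcases hn'.funct_cases hR with ⟨c', c₁', h2, rfl, h3⟩ | ⟨rfl, h2⟩ | h2
    · obtain ⟨rfl, -⟩ := Prod.mk.inj h2
      exact congrArg (·, []) (I.const_injective (hI.1.funct R hR _ _ _ hc hc'))
    · exact absurd ⟨_, h1⟩ h2
    · cases h2
    · subst h2
      exact absurd ⟨_, h3⟩ h1
    · rfl
    · exact absurd (h2 ▸ blocked_child _ _) h1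
    · cases h2
    · exact absurd (blocked_child _ _) h2
    · simp only [Null.child, Prod.mk.injEq, List.cons.injEq, true_and] at h2
      exact Prod.ext h2.1 h2.2

end Chase

/-! ### Most general unifiers -/

section Unification

variable {Δ : Type u} {NC : Type v} {NR : Type w}

theorem Term.eval_subst {D : Type*} (c : Δ → D) (μ : ℕ → D) (θ : ℕ → Term Δ) (t : Term Δ) :
    (t.subst θ).eval c μ = t.eval c fun y => (θ y).eval c μ := by
  cases t <;> rfl

theorem Term.subst_subst (η θ : ℕ → Term Δ) (t : Term Δ) :
    (t.subst θ).subst η = t.subst fun y => (θ y).subst η := by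
  cases t <;> rfl

/-- `θ` is an idempotent most general unifier of all the pairs related by `U`, it is compatible with
the valuation `μ`, and it introduces constants from `C` only. -/
structure IsIdemMGU {D : Type*} (c : Δ → D) (μ : ℕ → D) (C : Set Δ)
    (U : Term Δ → Term Δ → Prop) (θ : ℕ → Term Δ) : Prop where
  unify : ∀ s t, U s t → s.subst θ = t.subst θ
  general : ∀ η : ℕ → Term Δ, (∀ s t, U s t → s.subst η = t.subst η) → ∀ y, (θ y).subst η = η y
  eval : ∀ y, (θ y).eval c μ = μ y
  const : ∀ y d, θ y = .const d → d ∈ C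

variable {D : Type*} {c : Δ → D} {μ : ℕ → D} {C : Set Δ}

theorem IsIdemMGU.eval_subst {U : Term Δ → Term Δ → Prop} {θ : ℕ → Term Δ}
    (h : IsIdemMGU c μ C U θ) (t : Term Δ) : (t.subst θ).eval c μ = t.eval c μ := by
  simp only [Term.eval_subst, h.eval]

theorem IsIdemMGU.subst_const {U : Term Δ → Term Δ → Prop} {θ : ℕ → Term Δ}
    (h : IsIdemMGU c μ C U θ) {t : Term Δ} (ht : ∀ d, t = .const d → d ∈ C) {d : Δ}
    (hd : t.subst θ = .const d) : d ∈ C := by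
  cases t with
  | const a => exact ht d hd
  | var y => exact h.const y d hd

/-- Distinct constants have distinct values, so unless the terms are equal one of them is a
variable, and replacing it by the other term unifies them. The substitution respects the valuation
because both terms have the same value. -/
theorem exists_isIdemMGU (hc : Function.Injective c) {s t : Term Δ}
    (hst : s.eval c μ = t.eval c μ) (hs : ∀ d, s = .const d → d ∈ C)
    (ht : ∀ d, t = .const d → d ∈ C) :
    ∃ θ, IsIdemMGU c μ C (fun s' t' => s' = s ∧ t' = t) θ := by
  wlog hv : (∃ x, s = .var x) ∨ s = t generalizing s t
  · cases s with
    | var x => exact absurd (.inl ⟨x, rfl⟩) hv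
    | const a =>
      cases t with
      | const b => exact absurd (.inr (congrArg _ (hc hst))) hv
      | var x =>
        obtain ⟨θ, hθ⟩ := this hst.symm ht hs (.inl ⟨x, rfl⟩)
        refine ⟨θ, ⟨?_, ?_, hθ.eval, hθ.const⟩⟩
        · rintro _ _ ⟨rfl, rfl⟩
          exact (hθ.unify _ _ ⟨rfl, rfl⟩).symm
        · intro η hη
          refine hθ.general η ?_
          rintro _ _ ⟨rfl, rfl⟩
          exact (hη _ _ ⟨rfl, rfl⟩).symm
  classical
  by_cases he : s = t
  · refine ⟨.var, ⟨?_, fun η _ y => rfl, fun y => rfl, fun y d h => by cases h⟩⟩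
    rintro _ _ ⟨rfl, rfl⟩
    rw [he]
  · obtain ⟨x, rfl⟩ := hv.resolve_right he
    refine ⟨Function.update .var x t, ⟨?_, ?_, ?_, ?_⟩⟩
    · rintro _ t' ⟨rfl, rfl⟩
      cases t' with
      | const a => simp [Term.subst]
      | var y =>
        have : y ≠ x := fun h => he (h ▸ rfl)
        simp [Term.subst, this]
    · intro η hη y
      have := hη _ _ ⟨rfl, rfl⟩
      by_cases hy : y = x
      · subst hy
        simpa [Term.subst] using this.symm
      · simp [hy, Term.subst]
    · intro y
      by_cases hy : y = x
      · subst hy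
        simpa [Term.eval] using hst.symm
      · simp [hy, Term.eval]
    · intro y d hd
      by_cases hy : y = x
      · subst hy
        exact ht d (by simpa using hd)
      · simp [hy] at hd

/-- Serves role atoms: the first arguments are unified, then the images of the second ones. The
idempotent form of `general`, with the unifier itself as mediating substitution, is what makes the
two stages compose. -/
theorem IsIdemMGU.comp {U U' : Term Δ → Term Δ → Prop} {θ θ' : ℕ → Term Δ}
    (h : IsIdemMGU c μ C U θ)
    (h' : IsIdemMGU c μ C (fun s t => ∃ s' t', U' s' t' ∧ s = s'.subst θ ∧ t = t'.subst θ) θ') :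
    IsIdemMGU c μ C (fun s t => U s t ∨ U' s t) fun y => (θ y).subst θ' := by
  refine ⟨?_, ?_, ?_, ?_⟩
  · intro s t hst
    rw [← Term.subst_subst, ← Term.subst_subst]
    rcases hst with hst | hst
    · rw [h.unify s t hst]
    · exact h'.unify _ _ ⟨s, t, hst, rfl, rfl⟩
  · intro η hη y
    have h1 := h.general η fun s t hst => hη s t (.inl hst)
    have h2 := h'.general η (by
      rintro _ _ ⟨s, t, hst, rfl, rfl⟩
      simp only [Term.subst_subst, h1]
      exact hη s t (.inr hst))
    simp only [Term.subst_subst, h2, h1]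
  · intro y
    rw [h'.eval_subst, h.eval]
  · intro y d hd
    exact h'.subst_const (h.const y) hd

/-- Atoms with the same value under a valuation have a most general unifier compatible with it. -/
theorem exists_isMGU (hc : Function.Injective c) {g₁ g₂ : Atom NC NR (Term Δ)}
    (hg : g₁.map (Term.eval c μ) = g₂.map (Term.eval c μ))
    (h₁ : ∀ p d, g₁.At p (.const d) → d ∈ C) (h₂ : ∀ p d, g₂.At p (.const d) → d ∈ C) :
    ∃ θ, IsMGU θ g₁ g₂ ∧ (∀ y, (θ y).eval c μ = μ y) ∧ ∀ y d, θ y = .const d → d ∈ C := by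
  cases g₁ with
  | concept N t =>
    cases g₂ with
    | role => cases hg
    | concept N' t' =>
      obtain ⟨rfl, ht⟩ := Atom.concept.inj hg
      obtain ⟨θ, hθ⟩ := exists_isIdemMGU hc ht (by rintro d rfl; exact h₁ _ d (.concept ..))
        (by rintro d rfl; exact h₂ _ d (.concept ..))
      refine ⟨θ, ⟨congrArg (Atom.concept N) (hθ.unify _ _ ⟨rfl, rfl⟩), fun η hη => ⟨η, fun y => ?_⟩⟩,
        hθ.eval, hθ.const⟩
      refine (hθ.general η ?_ y).symm
      rintro _ _ ⟨rfl, rfl⟩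
      exact (Atom.concept.inj hη).2
  | role P s t =>
    cases g₂ with
    | concept => cases hg
    | role P' s' t' =>
      obtain ⟨rfl, hs, ht⟩ := Atom.role.inj hg
      obtain ⟨θ, hθ⟩ := exists_isIdemMGU hc hs (by rintro d rfl; exact h₁ _ d (.fst ..))
        (by rintro d rfl; exact h₂ _ d (.fst ..))
      obtain ⟨θ', hθ'⟩ := exists_isIdemMGU (C := C) (μ := μ) hc (s := t.subst θ) (t := t'.subst θ)
        (by rw [hθ.eval_subst, hθ.eval_subst, ht])
        (fun d h => hθ.subst_const (by rintro d rfl; exact h₁ _ d (.snd ..)) h)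
        (fun d h => hθ.subst_const (by rintro d rfl; exact h₂ _ d (.snd ..)) h)
      have h := hθ.comp (U' := fun a b => a = t ∧ b = t') (θ' := θ') (by
        convert hθ' using 3 with a b
        simp)
      refine ⟨_, ⟨?_, fun η hη => ⟨η, fun y => ?_⟩⟩, h.eval, h.const⟩
      · simp only [Atom.map]
        rw [h.unify _ _ (.inl ⟨rfl, rfl⟩), h.unify _ _ (.inr ⟨rfl, rfl⟩)]
      · refine (h.general η ?_ y).symm
        obtain ⟨-, h1, h2⟩ := Atom.role.inj hη
        rintro _ _ (⟨rfl, rfl⟩ | ⟨rfl, rfl⟩)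
        exacts [h1, h2]

end Unification

/-! ### Completeness of the rewriting -/

section Rewriting

variable {Δ : Type u} {NC : Type v} {NR : Type w} {X : Finset ℕ}
  {T : TBox NC NR} {A : Set (Atom NC NR Δ)} {f : Role NR → ℕ}

theorem Atom.finite_terms {τ : Type*} (g : Atom NC NR τ) : {t | ∃ p, g.At p t}.Finite := by
  cases g with
  | concept N t =>
    refine (Set.finite_singleton t).subset ?_
    rintro _ ⟨p, ⟨⟩⟩
    rfl
  | role P s t =>
    refine (Set.toFinite {s, t}).subset ?_
    rintro _ ⟨p, ⟨⟩⟩ <;> simp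

theorem Term.var_injective : Function.Injective (Term.var : ℕ → Term Δ) :=
  fun _ _ h => Term.var.inj h

theorem CQ.exists_fresh (q : CQ Δ NC NR X) (hq : q.body.Finite) : ∃ z, q.Fresh z := by
  have h1 : (Set.range q.head).Finite := Set.finite_range _
  have h2 : (⋃ g ∈ q.body, {t | ∃ p, g.At p t}).Finite := hq.biUnion fun g _ => g.finite_terms
  obtain ⟨z, hz⟩ := ((h1.union h2).preimage Term.var_injective.injOn).exists_notMem
  refine ⟨z, fun ⟨y, hy⟩ => hz (.inl ⟨y, hy⟩), fun g hg p hp => hz (.inr ?_)⟩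
  simp only [Set.mem_iUnion]
  exact ⟨g, hg, p, hp⟩

/-- The value of a term in the canonical interpretation. -/
abbrev Term.value (μ : ℕ → Null Δ) : Term Δ → Null Δ := Term.eval (fun c => (c, [])) μ

/-- The number of steps needed to derive a fact. -/
noncomputable def chaseRank (T : TBox NC NR) (A : Set (Atom NC NR Δ)) (f : Role NR → ℕ)
    (a : Atom NC NR (Null Δ)) : ℕ :=
  sInf {n | Chase T A f n a}

theorem Chase.rank_le {n : ℕ} {a : Atom NC NR (Null Δ)} (h : Chase T A f n a) :
    chaseRank T A f a ≤ n := Nat.sInf_le h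

theorem Chase.at_rank {a : Atom NC NR (Null Δ)} (h : ∃ n, Chase T A f n a) :
    Chase T A f (chaseRank T A f a) a := Nat.sInf_mem h

/-- `μ` maps the query into the canonical interpretation and its head to `ν`; the constants of the
query belong to `C`, and its distinguished variables occur in the body. -/
structure CQ.Match (T : TBox NC NR) (A : Set (Atom NC NR Δ)) (f : Role NR → ℕ) (C : Set Δ)
    (ν : ℕ → Δ) (q : CQ Δ NC NR X) (μ : ℕ → Null Δ) : Prop where
  head : ∀ y, (q.head y).value μ = (ν y, [])
  body : ∀ g ∈ q.body, ∃ n, Chase T A f n (g.map (Term.value μ))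
  head_const : ∀ y c, q.head y = .const c → c ∈ C
  body_const : ∀ g ∈ q.body, ∀ p c, g.At p (.const c) → c ∈ C
  safe : ∀ z, q.Distinguished z → ∃ g ∈ q.body, ∃ p, g.At p (.var z)

variable {C : Set Δ} {ν : ℕ → Δ} {q : CQ Δ NC NR X} {μ μ' : ℕ → Null Δ}

theorem CQ.map_value_congr (hμ : ∀ z, ¬ q.Fresh z → μ' z = μ z) {g : Atom NC NR (Term Δ)}
    (hg : g ∈ q.body) : g.map (Term.value μ') = g.map (Term.value μ) := by
  refine Atom.map_congr fun p t ht => ?_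
  cases t with
  | const c => rfl
  | var z => exact hμ z fun h => h.2 g hg p ht

/-- The valuation may change at fresh variables only, which leaves the remaining atoms and the head
untouched and lets the variable introduced by a rewriting step take the value it needs. -/
theorem CQ.Match.replace (h : q.Match T A f C ν μ) {g g' : Atom NC NR (Term Δ)} (hg : g ∈ q.body)
    (hμ : ∀ z, ¬ q.Fresh z → μ' z = μ z) (hg' : ∃ n, Chase T A f n (g'.map (Term.value μ')))
    (hc : ∀ p c, g'.At p (.const c) → ∃ p, g.At p (.const c))
    (hd : ∀ z p, g.At p (.var z) → q.Distinguished z → ∃ p, g'.At p (.var z)) :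
    (q.replace g g').Match T A f C ν μ' := by
  refine ⟨fun y => ?_, ?_, h.head_const, ?_, ?_⟩
  · rw [← h.head y]
    change (q.head y).value μ' = (q.head y).value μ
    cases hy : q.head y with
    | const c => rfl
    | var z => exact hμ z fun h => h.1 ⟨y, hy⟩
  · rintro k (rfl | ⟨hk, -⟩)
    · exact hg'
    · rw [CQ.map_value_congr hμ hk]
      exact h.body k hk
  · rintro k (rfl | ⟨hk, -⟩) p c hp
    · obtain ⟨p', hp'⟩ := hc p c hp
      exact h.body_const g hg p' c hp'
    · exact h.body_const k hk p c hp
  · intro z hz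
    obtain ⟨k, hk, p, hp⟩ := h.safe z hz
    by_cases hkg : k = g
    · subst hkg
      exact ⟨g', .inl rfl, hd z p hp hz⟩
    · exact ⟨k, .inr ⟨hk, hkg⟩, p, hp⟩

/-- A substitution compatible with `μ` changes no values, so the same valuation still matches. -/
theorem CQ.Match.subst (h : q.Match T A f C ν μ) {θ : ℕ → Term Δ}
    (hθ : ∀ y, (θ y).value μ = μ y) (hC : ∀ y d, θ y = .const d → d ∈ C) :
    (q.subst θ).Match T A f C ν μ := by
  have hv : ∀ t : Term Δ, (t.subst θ).value μ = t.value μ := fun t => by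
    rw [Term.value, Term.eval_subst]
    congr 1
    exact funext hθ
  have hs : ∀ (t : Term Δ) c, t.subst θ = .const c → t = .const c ∨ c ∈ C := by
    intro t c ht
    cases t with
    | const a => exact .inl ht
    | var y => exact .inr (hC y c ht)
  refine ⟨fun y => (hv _).trans (h.head y), ?_, ?_, ?_, ?_⟩
  · rintro _ ⟨g, hg, rfl⟩
    rw [Atom.map_map]
    simp only [hv]
    exact h.body g hg
  · intro y c hy
    exact (hs _ _ hy).elim (h.head_const y c) id
  · rintro _ ⟨g, hg, rfl⟩ p c hp
    obtain ⟨t, ht, htc⟩ := Atom.at_map.1 hp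
    exact (hs _ _ htc).elim (fun e => h.body_const g hg p c (e ▸ ht)) id
  · rintro z ⟨y, hy⟩
    change (q.head y).subst θ = _ at hy
    cases hz : q.head y with
    | const c => rw [hz] at hy; cases hy
    | var z' =>
      obtain ⟨g, hg, p, hp⟩ := h.safe z' ⟨y, hz⟩
      rw [hz] at hy
      exact ⟨_, ⟨g, hg, rfl⟩, p, Atom.at_map.2 ⟨_, hp, hy⟩⟩

/-- The total rank of the images of a set of atoms, each counted with one more. -/
noncomputable def weight (T : TBox NC NR) (A : Set (Atom NC NR Δ)) (f : Role NR → ℕ)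
    (μ : ℕ → Null Δ) (b : Finset (Atom NC NR (Term Δ))) : ℕ :=
  ∑ g ∈ b, (chaseRank T A f (g.map (Term.value μ)) + 1)

/-- A rewriting step leads to a query with a match of smaller weight. -/
def CQ.Progress (T : TBox NC NR) (A : Set (Atom NC NR Δ)) (f : Role NR → ℕ) (C : Set Δ)
    (ν : ℕ → Δ) (q : CQ Δ NC NR X) (n : ℕ) : Prop :=
  ∃ q' μ', RewStep T q q' ∧ q'.Match T A f C ν μ' ∧ ∃ b' : Finset _, q'.body = b' ∧
    weight T A f μ' b' < n

variable {b : Finset (Atom NC NR (Term Δ))}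

theorem CQ.Match.progress_replace (h : q.Match T A f C ν μ) (hb : q.body = b)
    {g g' : Atom NC NR (Term Δ)} (hg : g ∈ q.body) (hstep : RewStep T q (q.replace g g'))
    (hμ : ∀ z, ¬ q.Fresh z → μ' z = μ z)
    {n : ℕ} (hg' : Chase T A f n (g'.map (Term.value μ')))
    (hn : n < chaseRank T A f (g.map (Term.value μ)))
    (hc : ∀ p c, g'.At p (.const c) → ∃ p, g.At p (.const c))
    (hd : ∀ z p, g.At p (.var z) → q.Distinguished z → ∃ p, g'.At p (.var z)) :
    q.Progress T A f C ν (weight T A f μ b) := by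
  classical
  refine ⟨_, μ', hstep, h.replace hg hμ ⟨n, hg'⟩ hc hd, insert g' (b.erase g), ?_, ?_⟩
  · simp [CQ.replace, hb]
  · have hgb : g ∈ b := by rwa [hb, Finset.mem_coe] at hg
    have h1 : weight T A f μ' (b.erase g) = weight T A f μ (b.erase g) := by
      refine Finset.sum_congr rfl fun k hk => ?_
      rw [CQ.map_value_congr hμ (hb ▸ Finset.mem_of_mem_erase hk)]
    -- Only an inequality, since the new atom may already be in the body.
    have h2 : weight T A f μ' (insert g' (b.erase g)) ≤
        (chaseRank T A f (g'.map (Term.value μ')) + 1) + weight T A f μ' (b.erase g) := by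
      by_cases hm : g' ∈ b.erase g
      · rw [Finset.insert_eq_of_mem hm]
        exact Nat.le_add_left _ _
      · exact (Finset.sum_insert hm).le
    have h3 : weight T A f μ (b.erase g) + (chaseRank T A f (g.map (Term.value μ)) + 1) =
        weight T A f μ b := Finset.sum_erase_add _ _ hgb
    have h4 := hg'.rank_le
    omega

/-- Merging two atoms removes a summand of the weight. The extra 1 in each summand makes the
decrease strict even for atoms of rank 0. -/
theorem CQ.Match.progress_reduce (h : q.Match T A f C ν μ) (hb : q.body = b)
    {g₁ g₂ : Atom NC NR (Term Δ)} (h₁ : g₁ ∈ q.body) (h₂ : g₂ ∈ q.body) (hne : g₁ ≠ g₂)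
    (heq : g₁.map (Term.value μ) = g₂.map (Term.value μ)) :
    q.Progress T A f C ν (weight T A f μ b) := by
  classical
  obtain ⟨θ, hθ, hev, hC⟩ := exists_isMGU (fun _ _ h => (Prod.mk.inj h).1) heq
    (h.body_const _ h₁) (h.body_const _ h₂)
  refine ⟨_, μ, .reduce q g₁ g₂ θ h₁ h₂ hne hθ, h.subst hev hC,
    b.image (Atom.map (Term.subst θ)), by simp [CQ.subst, hb], ?_⟩
  have hv : ∀ t : Term Δ, (t.subst θ).value μ = t.value μ := fun t => by
    rw [Term.value, Term.eval_subst]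
    congr 1
    exact funext hev
  have hb₁ : g₁ ∈ b := by rwa [hb, Finset.mem_coe] at h₁
  have hb₂ : g₂ ∈ b := by rwa [hb, Finset.mem_coe] at h₂
  have him : b.image (Atom.map (Term.subst θ)) = (b.erase g₁).image (Atom.map (Term.subst θ)) := by
    refine (Finset.image_subset_iff.2 fun k hk => ?_).antisymm
      (Finset.image_subset_image (Finset.erase_subset _ _))
    by_cases hk1 : k = g₁
    · rw [hk1, hθ.1]
      exact Finset.mem_image_of_mem _ (Finset.mem_erase.2 ⟨hne.symm, hb₂⟩)
    · exact Finset.mem_image_of_mem _ (Finset.mem_erase.2 ⟨hk1, hk⟩)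
  have h1 : weight T A f μ ((b.erase g₁).image (Atom.map (Term.subst θ))) ≤
      weight T A f μ (b.erase g₁) := by
    refine (Finset.sum_image_le_of_nonneg fun _ _ => Nat.zero_le _).trans_eq ?_
    refine Finset.sum_congr rfl fun k _ => ?_
    rw [Atom.map_map]
    simp only [hv]
  have h3 : weight T A f μ (b.erase g₁) + (chaseRank T A f (g₁.map (Term.value μ)) + 1) =
      weight T A f μ b := Finset.sum_erase_add _ _ hb₁
  rw [him]
  omega

/-- The last chase step deriving the image of an atom is undone by applying the same inclusion
backwards. The only obstacle is an existential step whose created element is the value of a bound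
variable; two atoms can then be unified. -/
theorem CQ.Match.progress (hf : T.Coding f) (h : q.Match T A f C ν μ) (hb : q.body = b)
    (hr : ∃ g ∈ b, chaseRank T A f (g.map (Term.value μ)) ≠ 0) :
    q.Progress T A f C ν (weight T A f μ b) := by
  classical
  obtain ⟨g₀, hg₀, hr₀⟩ := hr
  -- Maximal rank matters when the variable is bound: a further atom on the created element cannot
  -- be derived later than `g`.
  obtain ⟨g, hgb, hmax⟩ := b.exists_max_image
    (fun g => chaseRank T A f (g.map (Term.value μ))) ⟨g₀, hg₀⟩
  have hg : g ∈ q.body := hb ▸ hgb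
  have hr : chaseRank T A f (g.map (Term.value μ)) ≠ 0 := by
    have := hmax g₀ hg₀
    omega
  -- The fresh variable will take the second argument `e` of the premise of the chase step as its
  -- value.
  obtain ⟨z, hz⟩ := q.exists_fresh (hb ▸ b.finite_toSet)
  have hupd : ∀ e x, ¬ q.Fresh x → Function.update μ z e x = μ x := by
    intro e x hx
    rw [Function.update_of_ne]
    rintro rfl
    exact hx hz
  have hval : ∀ e p t, g.At p t → t.value (Function.update μ z e) = t.value μ := by
    intro e p t ht
    cases t with
    | const c => rfl
    | var x => exact hupd e x fun h => h.2 g hg p ht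
  have hch := Chase.at_rank (h.body g hg)
  generalize hn : chaseRank T A f (g.map (Term.value μ)) = n at hch hr
  generalize ha : g.map (Term.value μ) = a at hch
  cases hch with
  | base => exact absurd rfl hr
  | concept n B N d e hB hd =>
    cases g with
    | role => cases ha
    | concept N' t =>
      obtain ⟨rfl, rfl⟩ := Atom.concept.inj ha
      have ht := hval e _ _ (.concept N' t)
      refine h.progress_replace hb hg (.conceptName q B N' t z hB hg hz) (hupd e) (n := n) ?_
        (by omega) ?_ ?_
      · rw [BasicConcept.map_atom, ht]
        simpa [Term.value, Term.eval] using hd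
      · intro p c hp
        rcases BasicConcept.at_atom hp with hp | hp
        · exact ⟨.concept N', hp ▸ Atom.At.concept N' t⟩
        · cases hp
      · rintro x p ⟨⟩ -
        exact BasicConcept.atom_at_left _ _ _
  | role n R R' d e hR hd =>
    obtain ⟨s, t, rfl, rfl, rfl⟩ := Role.map_eq_atom ha
    refine h.progress_replace hb hg (.role q R R' s t hR hg) (fun _ _ => rfl) (n := n)
      (by rwa [Role.map_atom]) (by omega) ?_ ?_
    · intro p c hp
      rcases Role.at_atom hp with hp | hp
      · exact hp ▸ Role.atom_at_left _ _ _
      · exact hp ▸ Role.atom_at_right _ _ _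
    · intro x p hp _
      rcases Role.at_atom hp with hp | hp
      · exact hp ▸ Role.atom_at_left _ _ _
      · exact hp ▸ Role.atom_at_right _ _ _
  | exist n B R d e hB hd hbl =>
    obtain ⟨t, s, rfl, rfl, hs⟩ := Role.map_eq_atom ha
    cases s with
    | const c => simp [Null.child, Term.value, Term.eval] at hs
    | var y =>
      -- Head terms take constants as values, and a created element is not a constant.
      have hny : ¬ q.Distinguished y := by
        rintro ⟨x, hx⟩
        have := h.head x
        rw [hx, hs] at this
        simp [Null.child] at this
      by_cases hu : q.UnboundIn R t y
      · obtain ⟨p, hp⟩ := Role.atom_at_left (NC := NC) R t (.var y)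
        have ht := hval e _ _ hp
        refine h.progress_replace hb hg (.conceptEx q B R t y z hB hg hu hz) (hupd e) (n := n) ?_
          (by omega) ?_ ?_
        · rw [BasicConcept.map_atom, ht]
          simpa [Term.value, Term.eval] using hd
        · intro p c hp
          rcases BasicConcept.at_atom hp with hp | hp
          · exact hp ▸ Role.atom_at_left _ _ _
          · cases hp
        · intro x p hp hx
          rcases Role.at_atom hp with hp | hp
          · exact hp ▸ BasicConcept.atom_at_left _ _ _
          · cases hp
            exact absurd hx hny
      · have hty : t ≠ .var y := by
          rintro rfl
          have := congrArg (fun d => d.2.length) hs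
          simp [Null.child] at this
        have : ∃ g' ∈ q.body, g' ≠ R.atom NC t (.var y) ∧ ∃ p, g'.At p (.var y) := by
          by_contra hcon
          exact hu ⟨hny, hty, fun g' hg' hne p hp => hcon ⟨g', hg', hne, p, hp⟩⟩
        obtain ⟨g', hg', hne, p, hp⟩ := this
        refine h.progress_reduce hb hg hg' hne.symm ?_
        have hp' : (g'.map (Term.value μ)).At p ((t.value μ).child f R) :=
          Atom.at_map.2 ⟨_, hp, hs⟩
        -- The image of `g` is the fact that creates this element. Either it precedes the image of
        -- `g'`, against maximality, or the two images coincide and the atoms unify.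
        obtain ⟨S, hS, hSR, m, hm, hlt⟩ := (Chase.at_rank (h.body g' hg')).exists_creation hp'
        obtain rfl := hf (.inl hS) (.inl ⟨B, hB⟩) hSR
        rw [ha]
        rcases hlt with hlt | heq
        · have h1 := hmax g' (by rwa [hb, Finset.mem_coe] at hg')
          have h2 : chaseRank T A f ((S.atom NC t (.var y)).map (Term.value μ)) ≤ m := by
            rw [ha]
            exact hm.rank_le
          omega
        · exact heq.symm

/-- Induction on the weight. When no atom has positive rank, all images are derived in 0 steps, so
they are ABox facts. -/
theorem CQ.Match.exists_rewriting (hf : T.Coding f) (h : q.Match T A f C ν μ) (hq : q.body.Finite) :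
    ∃ q' μ', Relation.ReflTransGen (RewStep T) q q' ∧ q'.Match T A f C ν μ' ∧
      ∀ g ∈ q'.body, ∃ a ∈ A, g.map (Term.value μ') = a.map fun c => (c, []) := by
  classical
  obtain ⟨b, hb⟩ := hq.exists_finset_coe
  obtain ⟨n, hn⟩ : ∃ n, weight T A f μ b = n := ⟨_, rfl⟩
  induction n using Nat.strong_induction_on generalizing q μ b with
  | _ n ih =>
    by_cases hr : ∃ g ∈ b, chaseRank T A f (g.map (Term.value μ)) ≠ 0
    · obtain ⟨q₁, μ₁, hs, hm, b₁, hb₁, hlt⟩ := h.progress hf hb.symm hr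
      obtain ⟨q', μ', h1, h2, h3⟩ :=
        ih _ (hn ▸ hlt) hm (hb₁ ▸ b₁.finite_toSet) b₁ hb₁.symm rfl
      exact ⟨q', μ', .head hs h1, h2, h3⟩
    · refine ⟨q, μ, .refl, h, fun g hg => ?_⟩
      have h0 : chaseRank T A f (g.map (Term.value μ)) = 0 := by
        by_contra hcon
        exact hr ⟨g, by rwa [← hb, Finset.mem_coe] at hg, hcon⟩
      have hch := Chase.at_rank (h.body g hg)
      rw [h0] at hch
      generalize g.map (Term.value μ) = a at hch
      cases hch with
      | base a ha => exact ⟨a, ha, rfl⟩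

/-- The constants of a union of conjunctive queries. -/
def UCQ.consts (q : UCQ Δ NC NR) : Set Δ :=
  {c | ∃ conj ∈ q.disjuncts, ∃ g ∈ conj, ∃ p, g.At p (.const c)}

theorem UCQ.finite_consts (q : UCQ Δ NC NR) : q.consts.Finite := by
  have h : (⋃ conj ∈ q.disjuncts, ⋃ g ∈ conj, {t | ∃ p, g.At p t}).Finite :=
    q.disjuncts.finite_toSet.biUnion fun conj _ => conj.finite_toSet.biUnion fun g _ =>
      g.finite_terms
  refine (h.preimage (f := Term.const) fun _ _ _ _ hab => Term.const.inj hab).subset ?_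
  rintro c ⟨conj, hc, g, hg, p, hp⟩
  simp only [Set.mem_preimage, Set.mem_iUnion]
  exact ⟨conj, hc, g, hg, p, hp⟩

/-- A value of an answer variable in a certain answer is a constant of the query, or it occurs in
the ABox at a position of the variable in the perfect rewriting. -/
theorem UCQ.Certain.value_cases {q : UCQ Δ NC NR} (hA : Consistent T A) {ν : ℕ → Δ}
    (h : q.Certain T A ν) (y : {y // y ∈ q.fv}) :
    ν y ∈ q.consts ∨
      ∃ p, (∃ q' ∈ q.rew T, q'.AnswerVarAt y p) ∧ ∃ a ∈ A, a.At p (ν y) := by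
  obtain ⟨f, hf⟩ := T.exists_coding
  obtain ⟨conj, hconj, μ, hμ, hbody⟩ := h _ _ (chaseInterp_isModel hA hf)
  have hm : CQ.Match T A f q.consts ν
      (⟨fun y => .var y, (conj : Set (Atom NC NR (Term Δ)))⟩ : CQ Δ NC NR q.fv) μ := by
    refine ⟨fun y => hμ y y.2, fun g hg => (chaseInterp_holds _).1 (hbody g hg),
      fun y c hc => (nomatch hc), fun g hg p c hp => ⟨conj, hconj, g, hg, p, hp⟩, ?_⟩
    rintro z ⟨y, hy⟩
    obtain rfl := Term.var.inj hy
    exact q.safe conj hconj y y.2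
  obtain ⟨q', μ', hrew, hm', hA'⟩ := hm.exists_rewriting hf conj.finite_toSet
  cases hy : q'.head y with
  -- Unification may have replaced the answer variable by a constant; it then comes from the query.
  | const c =>
    have := hm'.head y
    rw [hy] at this
    obtain rfl : c = ν y := (Prod.mk.inj this).1
    exact .inl (hm'.head_const y _ hy)
  | var z =>
    obtain ⟨g, hg, p, hp⟩ := hm'.safe z ⟨y, hy⟩
    refine .inr ⟨p, ⟨q', ⟨conj, hconj, hrew⟩, z, hy, g, hg, hp⟩, ?_⟩
    obtain ⟨a, ha, hga⟩ := hA' g hg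
    refine ⟨a, ha, ?_⟩
    have h1 : (g.map (Term.value μ')).At p (ν y, []) := by
      refine Atom.at_map.2 ⟨_, hp, ?_⟩
      rw [← hy]
      exact hm'.head y
    rw [hga] at h1
    obtain ⟨c, hc, hcν⟩ := Atom.at_map.1 h1
    exact (Prod.mk.inj hcν).1 ▸ hc

end Rewriting

/-! ### Consistent query answers -/

section Repairs

variable {Δ : Type u} {NC : Type v} {NR : Type w} {T : TBox NC NR} {A B : Set (Atom NC NR Δ)}

theorem Consistent.mono (h : Consistent T A) (hBA : B ⊆ A) : Consistent T B :=
  let ⟨D, I, hI⟩ := h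
  ⟨D, I, hI.1, fun a ha => hI.2 a (hBA ha)⟩

/-- Excludes the vacuous case in which there are no repairs and every assignment from the active
domain would be a consistent-query answer. A finite ABox has finitely many consistent subsets, the
empty one among them. -/
theorem exists_isRepair (hT : Consistent T (∅ : Set (Atom NC NR Δ))) (hA : A.Finite) :
    ∃ A', IsRepair T A A' := by
  have hfin : {B : Set (Atom NC NR Δ) | B ⊆ A ∧ Consistent T B}.Finite :=
    hA.finite_subsets.subset fun B hB => hB.1
  obtain ⟨A', -, h⟩ := hfin.exists_le_maximal (a := ∅) ⟨Set.empty_subset _, hT⟩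
  exact ⟨A', h⟩

/-- A value of an answer variable in a consistent-query answer is a constant of the query, or it
occurs in the ABox at a position of the variable in the perfect rewriting. -/
theorem UCQ.Cqa.value_cases {q : UCQ Δ NC NR} {ν : ℕ → Δ}
    (hT : Consistent T (∅ : Set (Atom NC NR Δ))) (hA : A.Finite) (h : q.Cqa T A ν)
    (y : {y // y ∈ q.fv}) :
    ν y ∈ q.consts ∨
      ∃ p, (∃ q' ∈ q.rew T, q'.AnswerVarAt y p) ∧ ∃ a ∈ A, a.At p (ν y) := by
  obtain ⟨A', hA'⟩ := exists_isRepair hT hA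
  rcases (h.2 A' hA').value_cases hA'.prop.2 y with h1 | ⟨p, hp, a, ha, hd⟩
  · exact .inl h1
  · exact .inr ⟨p, hp, a, hA'.prop.1 ha, hd⟩

theorem finite_adom (hA : A.Finite) : (adom A).Finite := by
  refine (hA.biUnion fun a _ => a.finite_terms).subset ?_
  rintro d ⟨a, ha, h⟩
  exact Set.mem_biUnion ha h

end Repairs

/-! ### Execution steps -/

section Steps

variable {Δ : Type u} {NC : Type v} {NR : Type w} {F : Type x} {ar : F → ℕ}

theorem EffTerm.ground_congr {ν ν' : ℕ → Δ} {t : EffTerm Δ ar} (h : ∀ y ∈ t.vars, ν y = ν' y) :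
    t.ground ν = t.ground ν' := by
  cases t with
  | const c => rfl
  | var y => exact congrArg _ (h y rfl)
  | call f ys =>
    have : (fun i => ν (ys i)) = fun i => ν' (ys i) := funext fun i => h _ ⟨i, rfl⟩
    simp only [EffTerm.ground, this]

/-- A produced fact depends only on the values of the free variables of q⁺, which range over the
finite active domain. Reachable ABoxes are therefore finite and have repairs. -/
theorem finite_doEffects [Nonempty Δ] (T : TBox NC NR) {A : Set (Atom NC NR Δ)} (hA : A.Finite)
    (α : Action Δ NC NR ar) (σ : ℕ → Δ) : (doEffects T A α σ).Finite := by
  classical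
  have hext : ∀ e : Effect Δ NC NR ar, (Set.pi Set.univ fun _ : {y // y ∈ e.qpos.fv} =>
      adom A).Finite := fun e => Set.Finite.pi fun _ => finite_adom hA
  -- The default outside the free variables is harmless, since the facts of an effect use no other
  -- variables.
  let ext (e : Effect Δ NC NR ar) (μ : {y // y ∈ e.qpos.fv} → Δ) (y : ℕ) : Δ :=
    if h : y ∈ e.qpos.fv then μ ⟨y, h⟩ else Classical.arbitrary Δ
  have hfin : (⋃ e ∈ α.effects, ⋃ a ∈ e.facts,
      (fun μ => a.map (EffTerm.ground (ext e μ))) '' Set.pi Set.univ fun _ => adom A).Finite :=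
    α.effects.finite_toSet.biUnion fun e _ => e.facts.finite_toSet.biUnion fun a _ =>
      (hext e).image _
  refine hfin.subset ?_
  rintro g ⟨e, he, ν, -, hν, a, ha, rfl⟩
  simp only [Set.mem_iUnion]
  refine ⟨e, he, a, ha, fun y => ν y, fun y _ => hν.2.1.1 y y.2, ?_⟩
  refine Atom.map_congr fun p t ht => EffTerm.ground_congr fun y hy => ?_
  simp [ext, e.fv_facts a ha p t ht y hy]

/-- The constants of the initial ABox and of the queries of the effects. -/
def KAB.baseValues (K : KAB Δ NC NR ar) : Set Δ :=
  adom (K.abox₀ : Set (Atom NC NR Δ)) ∪ ⋃ α ∈ K.actions, ⋃ e ∈ α.effects, e.qpos.consts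

/-- The positions that occur in the initial ABox or in the effects. -/
def KAB.positions (K : KAB Δ NC NR ar) : Set (Position NC NR) :=
  (⋃ a ∈ K.abox₀, {p | ∃ d, a.At p d}) ∪
    ⋃ α ∈ K.actions, ⋃ e ∈ α.effects, ⋃ a ∈ e.facts, {p | ∃ t, a.At p t}

/-- The service functions that occur in the effects. -/
def KAB.functions (K : KAB Δ NC NR ar) : Set F :=
  ⋃ α ∈ K.actions, ⋃ e ∈ α.effects, ⋃ a ∈ e.facts, {f | ∃ p ys, a.At p (.call f ys)}

theorem Atom.finite_positions {τ : Type*} (g : Atom NC NR τ) : {p | ∃ t, g.At p t}.Finite := by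
  cases g with
  | concept N t =>
    refine (Set.finite_singleton (.concept N)).subset ?_
    rintro p ⟨_, ⟨⟩⟩
    rfl
  | role P s t =>
    refine (Set.toFinite {.fst P, .snd P}).subset ?_
    rintro p ⟨_, ⟨⟩⟩ <;> simp

theorem KAB.finite_baseValues (K : KAB Δ NC NR ar) : K.baseValues.Finite :=
  (finite_adom K.abox₀.finite_toSet).union <| K.actions.finite_toSet.biUnion fun α _ =>
    α.effects.finite_toSet.biUnion fun e _ => e.qpos.finite_consts

theorem KAB.finite_positions (K : KAB Δ NC NR ar) : K.positions.Finite :=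
  (K.abox₀.finite_toSet.biUnion fun a _ => a.finite_positions).union <|
    K.actions.finite_toSet.biUnion fun α _ => α.effects.finite_toSet.biUnion fun e _ =>
      e.facts.finite_toSet.biUnion fun a _ => a.finite_positions

theorem KAB.finite_functions (K : KAB Δ NC NR ar) : K.functions.Finite := by
  refine K.actions.finite_toSet.biUnion fun α _ => α.effects.finite_toSet.biUnion fun e _ =>
    e.facts.finite_toSet.biUnion fun a _ => ?_
  have h : (⋃ t ∈ {t | ∃ p, a.At p t}, {f | ∃ ys, t = EffTerm.call f ys}).Finite := by
    refine a.finite_terms.biUnion fun t _ => Set.Subsingleton.finite ?_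
    rintro f ⟨ys, rfl⟩ f' ⟨ys', h⟩
    exact (EffTerm.call.inj h).1
  refine h.subset ?_
  rintro f ⟨p, ys, hp⟩
  exact Set.mem_biUnion (show _ ∈ {t | ∃ p, a.At p t} from ⟨p, hp⟩) ⟨ys, rfl⟩

theorem KAB.consistent_empty (K : KAB Δ NC NR ar) :
    Consistent K.tbox (∅ : Set (Atom NC NR Δ)) :=
  K.consistent₀.mono (Set.empty_subset _)

theorem KAB.ItReachable.finite_abox [Nonempty Δ] {K : KAB Δ NC NR ar} {s : State Δ NC NR ar}
    (h : K.ItReachable s) : s.abox.Finite := by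
  induction h with
  | init => exact K.abox₀.finite_toSet
  | step _ _ hex ih =>
    obtain ⟨-, θ, -, hab, -⟩ := hex
    rw [hab]
    exact (finite_doEffects _ ih _ _).image _

/-- The values at a position of an ABox. -/
def valuesAt (A : Set (Atom NC NR Δ)) (p : Position NC NR) : Set Δ := {d | ∃ a ∈ A, a.At p d}

variable {K : KAB Δ NC NR ar} {s s' : State Δ NC NR ar} {α : Action Δ NC NR ar} {σ : ℕ → Δ}

/-- The origin of the values produced by an execution step. -/
theorem KAB.Exec.value_cases (hα : α ∈ K.actions) (hs : s.abox.Finite) (h : K.Exec s α σ s')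
    {p : Position NC NR} {d : Δ} (hd : d ∈ valuesAt s'.abox p) :
    p ∈ K.positions ∧ (d ∈ K.baseValues ∨
      (∃ p', K.OrdinaryEdge p' p ∧ d ∈ valuesAt s.abox p') ∨
      ∃ f ∈ K.functions, ∃ ds : Fin (ar f) → Δ, s'.calls ⟨f, ds⟩ = some d ∧
        ∀ i, ds i ∈ K.baseValues ∨ ∃ p', K.SpecialEdge p' p ∧ ds i ∈ valuesAt s.abox p') := by
  obtain ⟨-, θ, -, hab, hcalls⟩ := h
  obtain ⟨b, hb, hbd⟩ := hd
  rw [hab] at hb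
  obtain ⟨g, hg, rfl⟩ := hb
  obtain ⟨e, he, ν, hνσ, hν, a, ha, rfl⟩ := id hg
  obtain ⟨r, hr, hrd⟩ := Atom.at_map.1 hbd
  obtain ⟨t, ht, rfl⟩ := Atom.at_map.1 hr
  have hval : ∀ y : {y // y ∈ e.qpos.fv}, ν y ∈ K.baseValues ∨
      ∃ p', (∃ q ∈ e.qpos.rew K.tbox, q.AnswerVarAt y p') ∧ ν y ∈ valuesAt s.abox p' := by
    intro y
    refine (hν.2.1.value_cases K.consistent_empty hs y).imp_left fun hc => .inr ?_
    simp only [Set.mem_iUnion]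
    exact ⟨α, hα, e, he, hc⟩
  refine ⟨.inr ?_, ?_⟩
  · simp only [Set.mem_iUnion]
    exact ⟨α, hα, e, he, a, ha, t, ht⟩
  cases t with
  | const c =>
    obtain rfl : c = d := hrd
    exact .inl (.inl (K.effect_consts α hα e he a ha p c ht))
  | var y =>
    obtain rfl : ν y = d := hrd
    have hy := e.fv_facts a ha p _ ht y rfl
    rcases hval ⟨y, hy⟩ with hb | ⟨p', hp', hv⟩
    · exact .inl hb
    · exact .inr (.inl ⟨p', ⟨α, hα, e, he, ⟨y, hy⟩, hp', a, ha, ht⟩, hv⟩)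
  | call f ys =>
    refine .inr (.inr ⟨f, ?_, fun i => ν (ys i), ?_, fun i => ?_⟩)
    · simp only [KAB.functions, Set.mem_iUnion]
      exact ⟨α, hα, e, he, a, ha, p, ys, ht⟩
    · have hsk : (⟨f, fun i => ν (ys i)⟩ : ServiceCall Δ ar) ∈
          skolems (doEffects K.tbox s.abox α σ) := ⟨_, hg, p, hr⟩
      rw [hcalls]
      simp only [if_pos hsk]
      exact congrArg some hrd
    · have hy := e.fv_facts a ha p _ ht (ys i) ⟨i, rfl⟩
      refine (hval ⟨ys i, hy⟩).imp_right ?_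
      rintro ⟨p', hp', hv⟩
      exact ⟨p', ⟨α, hα, e, he, ⟨ys i, hy⟩, hp', a, ha, f, ys, ht, i, rfl⟩, hv⟩

/-- New evaluations agree with recorded ones, so the call map only grows; hence services are
deterministic along a run. -/
theorem KAB.Exec.calls_mono (h : K.Exec s α σ s') {c : ServiceCall Δ ar} {d : Δ}
    (hc : s.calls c = some d) : s'.calls c = some d := by
  obtain ⟨-, θ, hθ, -, hcalls⟩ := h
  rw [hcalls]
  by_cases hsk : c ∈ skolems (doEffects K.tbox s.abox α σ)
  · simp only [if_pos hsk]
    exact congrArg some (hθ c hsk d hc)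
  · simpa only [if_neg hsk] using hc

end Steps

/-! ### Runs of weakly acyclic knowledge and action bases -/

section Runs

variable {Δ : Type u} {NC : Type v} {NR : Type w} {F : Type x} {ar : F → ℕ}
  {K : KAB Δ NC NR ar} {τ : ℕ → State Δ NC NR ar} {L : ℕ∞}

/-- The values that occur at a position along a run. -/
def runValues (τ : ℕ → State Δ NC NR ar) (L : ℕ∞) (p : Position NC NR) : Set Δ :=
  {d | ∃ i : ℕ, (i : ℕ∞) < L ∧ d ∈ valuesAt (τ i).abox p}

theorem KAB.IsRun.calls_mono (h : K.itTS.IsRun τ L) {i j : ℕ} (hij : i ≤ j) (hj : (j : ℕ∞) < L)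
    {c : ServiceCall Δ ar} {d : Δ} (hc : (τ i).calls c = some d) : (τ j).calls c = some d := by
  induction j, hij using Nat.le_induction with
  | base => exact hc
  | succ j hij ih =>
    obtain ⟨-, α, -, σ, hex⟩ := h.2.2 j hj
    exact hex.calls_mono (ih (lt_of_le_of_lt (by exact_mod_cast j.le_succ) hj))

/-- Along a run every service call returns one value. -/
theorem KAB.IsRun.exists_callValue [Nonempty Δ] (h : K.itTS.IsRun τ L) :
    ∃ val : ServiceCall Δ ar → Δ, ∀ (i : ℕ) c d, (i : ℕ∞) < L → (τ i).calls c = some d →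
      val c = d := by
  have : ∀ c : ServiceCall Δ ar, ∃ v, ∀ (i : ℕ) d, (i : ℕ∞) < L → (τ i).calls c = some d →
      v = d := by
    intro c
    by_cases hc : ∃ (i : ℕ) (d : Δ), (i : ℕ∞) < L ∧ (τ i).calls c = some d
    · obtain ⟨i, v, hi, hv⟩ := hc
      refine ⟨v, fun j d hj hd => ?_⟩
      rcases le_total i j with hij | hij
      · exact Option.some.inj ((KAB.IsRun.calls_mono h hij hj hv).symm.trans hd)
      · exact Option.some.inj (hv.symm.trans (KAB.IsRun.calls_mono h hij hi hd))
    · exact ⟨Classical.arbitrary Δ, fun i d hi hd => absurd ⟨i, d, hi, hd⟩ hc⟩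
  choose val hval using this
  exact ⟨val, fun i c d => hval c i d⟩

/-- Some path from `p` to `p'` in the dependency graph goes through a special edge. -/
def KAB.Precedes (K : KAB Δ NC NR ar) (p p' : Position NC NR) : Prop :=
  ∃ u v, Relation.ReflTransGen (fun p p' => K.OrdinaryEdge p p' ∨ K.SpecialEdge p p') p u ∧
    K.SpecialEdge u v ∧
    Relation.ReflTransGen (fun p p' => K.OrdinaryEdge p p' ∨ K.SpecialEdge p p') v p'

theorem KAB.Precedes.trans {p₁ p₂ p₃ : Position NC NR} (h : K.Precedes p₁ p₂)
    (h' : K.Precedes p₂ p₃) : K.Precedes p₁ p₃ := by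
  obtain ⟨u, v, h1, h2, h3⟩ := h
  obtain ⟨u', v', h1', h2', h3'⟩ := h'
  exact ⟨u, v, h1, h2, h3.trans (h1'.trans (.head (.inr h2') h3'))⟩

theorem KAB.WeaklyAcyclic.not_precedes_self (hK : K.WeaklyAcyclic) (p : Position NC NR) :
    ¬ K.Precedes p p := by
  rintro ⟨u, v, h1, h2, h3⟩
  exact hK u v h2 (h3.trans h1)

theorem mem_positions_of_mem_runValues [Nonempty Δ] (h : K.itTS.IsRun τ L) {p : Position NC NR}
    {d : Δ} (hd : d ∈ runValues τ L p) : p ∈ K.positions := by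
  obtain ⟨i, hi, hd⟩ := hd
  cases i with
  | zero =>
    rw [h.2.1] at hd
    obtain ⟨a, ha, hp⟩ := hd
    exact .inl (Set.mem_biUnion (show a ∈ K.abox₀ from ha) ⟨d, hp⟩)
  | succ i =>
    obtain ⟨hr, α, hα, σ, hex⟩ := h.2.2 i hi
    exact (hex.value_cases hα hr.finite_abox hd).1

/-- The base values together with the values at the preceding positions. -/
def priorValues (K : KAB Δ NC NR ar) (τ : ℕ → State Δ NC NR ar) (L : ℕ∞) (p : Position NC NR) :
    Set Δ :=
  K.baseValues ∪ ⋃ u ∈ {u ∈ K.positions | K.Precedes u p}, runValues τ L u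

/-- Induction on time, for all positions at once. A value moved along an ordinary edge keeps its
description from the source position, whose prior positions are also prior to the target. The source
of a special edge is itself prior to its target. -/
theorem runValues_subset [Nonempty Δ] (h : K.itTS.IsRun τ L) {val : ServiceCall Δ ar → Δ}
    (hval : ∀ (i : ℕ) c d, (i : ℕ∞) < L → (τ i).calls c = some d → val c = d)
    (p : Position NC NR) :
    runValues τ L p ⊆ K.baseValues ∪ ⋃ f ∈ K.functions,
      (fun ds => val ⟨f, ds⟩) '' {ds : Fin (ar f) → Δ | ∀ i, ds i ∈ priorValues K τ L p} := by
  rintro d ⟨i, hi, hd⟩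
  induction i generalizing p d with
  | zero =>
    rw [h.2.1] at hd
    obtain ⟨a, ha, hp⟩ := hd
    exact .inl (.inl ⟨a, ha, p, hp⟩)
  | succ i ih =>
    have hi' : (i : ℕ∞) < L := lt_of_le_of_lt (by exact_mod_cast i.le_succ) hi
    obtain ⟨hr, α, hα, σ, hex⟩ := h.2.2 i hi
    obtain ⟨-, hd | ⟨p', he, hd⟩ | ⟨f, hf, ds, hc, hds⟩⟩ :=
      hex.value_cases hα hr.finite_abox hd
    · exact .inl hd
    · refine (ih p' hi' hd).imp_right fun hd => ?_
      simp only [Set.mem_iUnion] at hd ⊢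
      obtain ⟨f, hf, ds, hds, rfl⟩ := hd
      refine ⟨f, hf, ds, fun j => (hds j).imp_right fun hj => ?_, rfl⟩
      simp only [Set.mem_iUnion] at hj ⊢
      obtain ⟨u, ⟨hu, u₁, v₁, h1, h2, h3⟩, hj⟩ := hj
      exact ⟨u, ⟨hu, u₁, v₁, h1, h2, h3.tail (.inl he)⟩, hj⟩
    · refine .inr ?_
      simp only [Set.mem_iUnion]
      refine ⟨f, hf, ds, fun j => (hds j).imp_right ?_, hval _ _ _ hi hc⟩
      rintro ⟨p', he, hj⟩
      have hj' : ds j ∈ runValues τ L p' := ⟨i, hi', hj⟩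
      simp only [Set.mem_iUnion]
      exact ⟨p', ⟨mem_positions_of_mem_runValues h hj', p', p, .refl, he, .refl⟩, hj'⟩

theorem encard_biUnion_le {ι β : Type*} (s : Finset ι) (t : ι → Set β) (b : ι → ℕ)
    (h : ∀ i ∈ s, (t i).encard ≤ b i) : (⋃ i ∈ s, t i).encard ≤ (∑ i ∈ s, b i : ℕ) := by
  rw [Nat.cast_sum]
  exact (s.set_encard_biUnion_le t).trans (Finset.sum_le_sum h)

theorem encard_tuples_le {β : Type*} {U : Set β} {N : ℕ} (hU : U.encard ≤ N) (n : ℕ) :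
    {ds : Fin n → β | ∀ i, ds i ∈ U}.encard ≤ (N ^ n : ℕ) := by
  classical
  have hfin : U.Finite := Set.finite_of_encard_le_coe hU
  have : {ds : Fin n → β | ∀ i, ds i ∈ U} =
      (Fintype.piFinset fun _ : Fin n => hfin.toFinset : Set (Fin n → β)) := by
    ext ds
    simp
  rw [this, Set.encard_coe_eq_coe_finsetCard, Fintype.card_piFinset_const]
  rw [hfin.encard_eq_coe_toFinset_card] at hU
  exact_mod_cast Nat.pow_le_pow_left (by exact_mod_cast hU) n

/-- With c base values and bounds b u at the prior positions u, a function of arity n has at most (c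
+ Σ b u)ⁿ relevant argument tuples, hence at most that many results. The bound is fixed before the
run is given. -/
theorem KAB.WeaklyAcyclic.exists_bound_runValues [Nonempty Δ] (hK : K.WeaklyAcyclic)
    (p : K.positions) : ∃ b : ℕ, ∀ τ L, K.itTS.IsRun τ L → (runValues τ L p).encard ≤ b := by
  classical
  have := K.finite_positions.to_subtype
  let r (p p' : K.positions) : Prop := K.Precedes p p'
  have : IsTrans _ r := ⟨fun _ _ _ => KAB.Precedes.trans⟩
  have : Std.Irrefl r := ⟨fun p => hK.not_precedes_self p⟩
  have hwf : WellFounded r := Finite.wellFounded_of_trans_of_irrefl r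
  induction p using hwf.induction with | _ p ih
  have hprec : {u ∈ K.positions | K.Precedes u p}.Finite :=
    K.finite_positions.subset fun u hu => hu.1
  -- The inductive bounds are extended to all positions, with value 0 where nothing is claimed, so
  -- that they can be summed as one function.
  have hb : ∀ u : Position NC NR, ∃ b : ℕ, u ∈ {u ∈ K.positions | K.Precedes u p} →
      ∀ τ L, K.itTS.IsRun τ L → (runValues τ L u).encard ≤ b := by
    intro u
    by_cases hu : u ∈ {u ∈ K.positions | K.Precedes u p}
    · obtain ⟨b, hb⟩ := ih ⟨u, hu.1⟩ hu.2
      exact ⟨b, fun _ => hb⟩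
    · exact ⟨0, fun h => absurd h hu⟩
  choose b hb using hb
  set c := K.finite_baseValues.toFinset.card
  have hc : K.baseValues.encard = c := K.finite_baseValues.encard_eq_coe_toFinset_card
  refine ⟨c + ∑ f ∈ K.finite_functions.toFinset, (c + ∑ u ∈ hprec.toFinset, b u) ^ ar f,
    fun τ L hrun => ?_⟩
  have hprior : (priorValues K τ L p).encard ≤ (c + ∑ u ∈ hprec.toFinset, b u : ℕ) := by
    refine (Set.encard_union_le _ _).trans ?_
    rw [hc, Nat.cast_add]
    refine add_le_add_right ?_ _
    have := encard_biUnion_le hprec.toFinset (runValues τ L) b fun u hu =>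
      hb u (hprec.mem_toFinset.1 hu) τ L hrun
    simpa only [Set.Finite.mem_toFinset] using this
  obtain ⟨val, hval⟩ := KAB.IsRun.exists_callValue hrun
  refine (Set.encard_le_encard (runValues_subset hrun hval p)).trans ?_
  refine (Set.encard_union_le _ _).trans ?_
  rw [hc, Nat.cast_add]
  refine add_le_add_right ?_ _
  have := encard_biUnion_le K.finite_functions.toFinset
    (fun f => (fun ds => val ⟨f, ds⟩) ''
      {ds : Fin (ar f) → Δ | ∀ i, ds i ∈ priorValues K τ L p})
    (fun f => (c + ∑ u ∈ hprec.toFinset, b u) ^ ar f) fun f _ =>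
      (Set.encard_image_le _ _).trans (encard_tuples_le hprior _)
  simpa only [Set.Finite.mem_toFinset] using this

end Runs

end DLKAB

/-- Each value of a run sits at one of the finitely many positions of `K`, so the bounds per
position add up; the extra 1 makes the inequality strict. -/
theorem mainTheorem7 {Δ : Type u} {NC : Type v} {NR : Type w} {F : Type x} {ar : F → ℕ}
    [Countable Δ] [Infinite Δ] (K : DLKAB.KAB Δ NC NR ar) (hK : K.WeaklyAcyclic) :
    K.itTS.RunBounded := by
  classical
  choose b hb using hK.exists_bound_runValues
  have := K.finite_positions.fintype
  refine ⟨∑ p, b p + 1, fun τ L hrun => ?_⟩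
  have hsub : (⋃ i ∈ {i : ℕ | (i : ℕ∞) < L}, DLKAB.adom (K.itTS.abox (τ i))) ⊆
      ⋃ p ∈ (Finset.univ : Finset K.positions), DLKAB.runValues τ L p := by
    intro d hd
    simp only [Set.mem_iUnion] at hd ⊢
    obtain ⟨i, hi, a, ha, p, hp⟩ := hd
    have hd : d ∈ DLKAB.runValues τ L p := ⟨i, hi, a, ha, hp⟩
    exact ⟨⟨p, DLKAB.mem_positions_of_mem_runValues hrun hd⟩, Finset.mem_univ _, hd⟩
  refine lt_of_le_of_lt ((Set.encard_le_encard hsub).trans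
    (DLKAB.encard_biUnion_le _ _ b fun p _ => hb p τ L hrun)) ?_
  exact_mod_cast Nat.lt_succ_self _
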